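/- **Setting.** Identify $\mathbb{R}^2$ with $\mathbb{C}$ via $z=x+i\xi$. For $g\in L^2(\mathbb{R})$ with $\|g\|_2=1$ let $V_gf(x,\xi)=\int_{\mathbb{R}} f(t)\overline{g(t-x)}e^{-2\pi i\xi t}\,dt$, $\mathcal{V}_g=\{V_gf: f\in L^2(\mathbb{R})\}\subseteq L^2(\mathbb{R}^2)$, and let $K^g(z,z')=\int_{\mathbb{R}} e^{2\pi i(\xi'-\xi)t}g(t-x')\overline{g(t-x)}\,dt$ be the kernel of the orthogonal projection onto $\mathcal{V}_g$. For $\Omega\subseteq\mathbb{C}$ of finite measure let $M^g_\Omega$ be the Toeplitz operator on $L^2(\mathbb{R}^2)$ with integral kernel $(z,z')\mapsto\int_\Omega K^g(z,u)K^g(u,z')\,du$. An *eigen-expansion* of $M^g_\Omega$ is $M^g_\Omega=\sum_{j\ge1}\lambda_j\,p_j\otimes p_j$, where $\lambda_1\ge\lambda_2\ge\dots>0$ are the non-zero eigenvalues of $M^g_\Omega$, repeated according to multiplicity, and $(p_j)\subset\mathcal{V}_g$ is a corresponding orthonormal sequence of eigenfunctions. With $N_\Omega=\lceil|\Omega|\rceil$,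 the finite Weyl–Heisenberg ensemble has the correlation kernel $$K_{g,\Omega}(z,z')=\sum_{j=1}^{N_\Omega}p_j(z)\overline{p_j(z')} .$$ The renormalization of a kernel $K$ is $\widetilde K(z,z')=e^{\pi i(x'\xi'-x\xi)}K(\overline z,\overline{z'})$, and that of a function $f$ is $\widetilde f(z)=e^{-\pi i x\xi}f(\overline z)$. For $r\ge0$ let $h_r(t)=\frac{2^{1/4}}{\sqrt{r!}}\big(\frac{-1}{2\sqrt\pi}\big)^r e^{\pi t^2}\frac{d^r}{dt^r}e^{-2\pi t^2}$ be the Hermite function. With $L_k^{\alpha}(s)=\sum_{i=0}^k(-1)^i\binom{k+\alpha}{k-i}\frac{s^i}{i!}$, the complex Hermite polynomials are $$H_{j,r}(z,\overline z)=\begin{cases}\sqrt{\tfrac{r!}{j!}}\,\pi^{\frac{j-r}2}z^{j-r}L_r^{j-r}(\pi|z|^2), & j>r\ge0,\\ (-1)^{r-j}\sqrt{\tfrac{j!}{r!}}\,\pi^{\frac{r-j}2}\overline z^{\,r-j}L_j^{r-j}(\pi|z|^2), & 0\le j\le r,\end{cases}$$ and the $(r,N)$-pure polyanalytic ensemble has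 the correlation kernel $$K_{r,N}(z,z')=e^{-\frac\pi2(|z|^2+|z'|^2)}\sum_{j=0}^{N-1}H_{j,r}(z,\overline z)\overline{H_{j,r}(z',\overline{z'})}.$$ Let $D_R=\{|z|\le R\}$, let $|\partial D_R|_1$ be the length of its boundary circle, and let $\|\cdot\|_{S^1}$ denote the trace norm of the integral operator on $L^2(\mathbb{R}^2)$ with the given kernel. **Theorem.** 1. For all $r\ge0$ and $R>0$ the operator $M^{h_r}_{D_R}$ has an eigen-expansion, and it can be chosen so that $\widetilde p_j(z)=H_{\sigma(j),r}(z,\overline z)e^{-\frac\pi2|z|^2}$ for all $j\ge 1$ and $z\in\mathbb{C}$, with a bijection $\sigma:\{1,2,\dots\}\to\{0,1,\dots\}$. (So the finite Weyl–Heisenberg ensemble uses the complex Hermite basis ordered by the size of the eigenvalues, and $K_{r,N}$ uses it ordered by the index $j$.) 2. For every $r\ge0$ there is a constant $C_r>0$ such that for all $N\in\mathbb{N}$ and $R>0$ with $N_{D_R}=\lceil|D_R|\rceil=N$, and for every choice of the eigen-expansion defining $K_{h_r,D_R}$, $$\big\|\widetilde K_{h_r,D_R}-K_{r,N}\big\|_{S^1}\le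 C_r\sqrt N,$$ and, if $|\partial D_R|_1\ge1$, also $$\big\|\widetilde K_{h_r,D_R}-K_{r,N}\big\|_{S^1}\le C_r\,|\partial D_R|_1 .$$ 3. There are absolute constants $c,C>0$ with $c\sqrt N\le|\partial D_R|_1\le C\sqrt N$ for all $N$ and $R>0$ with $\lceil|D_R|\rceil=N$ and $|\partial D_R|_1\ge1$. -/

import Mathlib

open MeasureTheory Complex
open scoped ComplexConjugate ENNReal Nat

namespace WeylHeisenberg

noncomputable section

/-! Phase space `ℝ²` is identified with `ℂ` through `z = x + iξ`, so `x = z.re` and `ξ = z.im`. -/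

/-! ### Trace norm and integral operators -/

section TraceNorm

variable {H : Type*} [NormedAddCommGroup H] [InnerProductSpace ℂ H] [CompleteSpace H]

/-- The trace `∑ᵢ ⟨A eᵢ, eᵢ⟩` of a positive operator `A`, with values in `[0, ∞]`. It is computed in
some orthonormal basis `(eᵢ)`; the value does not depend on the basis. -/
def positiveTrace (A : H →L[ℂ] H) : ℝ≥0∞ :=
  let b := (exists_hilbertBasis ℂ H).choose_spec.choose
  ∑' i, ENNReal.ofReal (RCLike.re (inner ℂ (b i) (A (b i))))

/-- The trace norm (Schatten 1-norm) `‖T‖_{S¹} = trace |T|`, where `|T| = (T* T)^{1/2}`.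
It is `∞` when `T` is not of trace class. -/
def traceNorm (T : H →L[ℂ] H) : ℝ≥0∞ := positiveTrace (CFC.abs T)

end TraceNorm

/-- `T` is the integral operator on `L²(ℝ²)` with kernel `K`: `T F (z) = ∫ K(z, w) F(w) dw`. -/
def HasIntegralKernel (T : Lp ℂ 2 (volume : Measure ℂ) →L[ℂ] Lp ℂ 2 (volume : Measure ℂ))
    (K : ℂ → ℂ → ℂ) : Prop :=
  ∀ F : Lp ℂ 2 (volume : Measure ℂ), ∀ᵐ z : ℂ,
    Integrable (fun w : ℂ => K z w * F w) ∧ T F z = ∫ w : ℂ, K z w * F w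

/-! ### Short-time Fourier transform and Toeplitz operators -/

/-- The short-time Fourier transform
`V_g f (x, ξ) = ∫ f(t) conj(g(t - x)) exp(-2πiξt) dt`. -/
def stft (g f : ℝ → ℂ) (z : ℂ) : ℂ :=
  ∫ t : ℝ, f t * conj (g (t - z.re)) * cexp (-2 * Real.pi * I * z.im * t)

/-- The space `𝒱_g = {V_g f : f ∈ L²(ℝ)}`, whose elements are genuine functions on phase space. -/
def stftRange (g : ℝ → ℂ) : Set (ℂ → ℂ) :=
  {F | ∃ f : ℝ → ℂ, MemLp f 2 volume ∧ F = stft g f}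

/-- The kernel `K^g(z, w) = ∫ exp(2πi(ξ_w - ξ_z)t) g(t - x_w) conj(g(t - x_z)) dt` of the infinite
Weyl-Heisenberg ensemble, the reproducing kernel of `𝒱_g` when `‖g‖₂ = 1`. -/
def whInfiniteKernel (g : ℝ → ℂ) (z w : ℂ) : ℂ :=
  ∫ t : ℝ, cexp (2 * Real.pi * I * (w.im - z.im) * t) * g (t - w.re) * conj (g (t - z.re))

/-- The integral kernel of the Toeplitz operator `M^g_Ω` (multiplication by `1_Ω` followed by
projection onto `𝒱_g`, extended by `0` to the orthogonal complement of `𝒱_g`). -/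
def toeplitzKernel (g : ℝ → ℂ) (Ω : Set ℂ) (z w : ℂ) : ℂ :=
  ∫ u in Ω, whInfiniteKernel g z u * whInfiniteKernel g u w

/-- `M^g_Ω = ∑_j λ_j p_j ⊗ p_j` is an eigen-expansion of the Toeplitz operator: `(λ_j)` are its
non-zero (hence positive) eigenvalues in non-increasing order, repeated according to multiplicity,
and `(p_j)` is a corresponding orthonormal sequence of eigenfunctions in `𝒱_g`.
Indexing starts at `0`. -/
structure IsToeplitzExpansion (g : ℝ → ℂ) (Ω : Set ℂ) (lam : ℕ → ℝ) (p : ℕ → ℂ → ℂ) : Prop where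
  lam_pos : ∀ j, 0 < lam j
  lam_antitone : Antitone lam
  mem_range : ∀ j, p j ∈ stftRange g
  memLp : ∀ j, MemLp (p j) 2 (volume : Measure ℂ)
  orthonormal : Orthonormal ℂ (fun j => (memLp j).toLp (p j))
  expansion : ∃ M : Lp ℂ 2 (volume : Measure ℂ) →L[ℂ] Lp ℂ 2 (volume : Measure ℂ),
    HasIntegralKernel M (toeplitzKernel g Ω) ∧
    ∀ F : Lp ℂ 2 (volume : Measure ℂ),
      HasSum (fun j => ((lam j : ℂ) * inner ℂ ((memLp j).toLp (p j)) F) • (memLp j).toLp (p j))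
        (M F)

/-- `N_Ω = ⌈|Ω|⌉`, with `|Ω|` the Lebesgue measure of `Ω`. -/
def whNumber (Ω : Set ℂ) : ℕ := ⌈(volume Ω).toReal⌉₊

/-- The correlation kernel `K_{g,Ω}(z, w) = ∑_{j ≤ N_Ω} p_j(z) conj(p_j(w))` of the finite
Weyl-Heisenberg ensemble, where `p` is the sequence of eigenfunctions of `M^g_Ω`. -/
def whKernel (Ω : Set ℂ) (p : ℕ → ℂ → ℂ) (z w : ℂ) : ℂ :=
  ∑ j ∈ Finset.range (whNumber Ω), p j z * conj (p j w)

/-- The renormalization `K̃(z, w) = exp(πi(x_w ξ_w - x_z ξ_z)) K(z̄, w̄)` of a kernel. -/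
def renormKernel (K : ℂ → ℂ → ℂ) (z w : ℂ) : ℂ :=
  cexp (Real.pi * I * (w.re * w.im - z.re * z.im)) * K (conj z) (conj w)

/-- The renormalization `f̃(z) = exp(-πi x ξ) f(z̄)` of a function; the renormalization of the kernel
`f(z) conj(f(w))` is `f̃(z) conj(f̃(w))`. -/
def renormFun (f : ℂ → ℂ) (z : ℂ) : ℂ :=
  cexp (-(Real.pi * I * (z.re * z.im))) * f (conj z)

/-! ### Hermite functions and complex Hermite polynomials -/

/-- The Hermite function
`h_r(t) = 2^{1/4} / √(r!) (-1 / (2√π))^r exp(πt²) (d/dt)^r exp(-2πt²)`. -/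
def hermiteFun (r : ℕ) (t : ℝ) : ℂ :=
  (((2 : ℝ) ^ (1 / 4 : ℝ) / √(r ! : ℝ) * (-1 / (2 * √Real.pi)) ^ r * Real.exp (Real.pi * t ^ 2) *
    iteratedDeriv r (fun s : ℝ => Real.exp (-2 * Real.pi * s ^ 2)) t : ℝ) : ℂ)

/-- The Laguerre polynomial `L_k^a(x) = ∑_{i ≤ k} (-1)^i binom(k + a, k - i) x^i / i!`. -/
def laguerre (k a : ℕ) (x : ℝ) : ℝ :=
  ∑ i ∈ Finset.range (k + 1), (-1) ^ i * ((k + a).choose (k - i) : ℝ) * x ^ i / (i ! : ℝ)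

/-- The complex Hermite polynomials `H_{j,r}(z, z̄)`. -/
def complexHermite (j r : ℕ) (z : ℂ) : ℂ :=
  if r < j then
    ((√((r ! : ℝ) / (j ! : ℝ)) * √Real.pi ^ (j - r) : ℝ) : ℂ) * z ^ (j - r) *
      (laguerre r (j - r) (Real.pi * ‖z‖ ^ 2) : ℂ)
  else
    (((-1) ^ (r - j) * √((j ! : ℝ) / (r ! : ℝ)) * √Real.pi ^ (r - j) : ℝ) : ℂ) *
      conj z ^ (r - j) * (laguerre j (r - j) (Real.pi * ‖z‖ ^ 2) : ℂ)

/-- The correlation kernel `K_{r,N}` of the finite `(r, N)`-pure polyanalytic ensemble. -/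
def purePolyKernel (r N : ℕ) (z w : ℂ) : ℂ :=
  (Real.exp (-(Real.pi / 2) * (‖z‖ ^ 2 + ‖w‖ ^ 2)) : ℂ) *
    ∑ j ∈ Finset.range N, complexHermite j r z * conj (complexHermite j r w)

/-- The disk `D_R = {z : |z| ≤ R}`. -/
def disk (R : ℝ) : Set ℂ := Metric.closedBall 0 R

/-- The perimeter `|∂Ω|₁`: the one-dimensional Hausdorff measure of the topological boundary. -/
def perimeter (Ω : Set ℂ) : ℝ≥0∞ := Measure.hausdorffMeasure 1 (frontier Ω)

end

end WeylHeisenberg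

open WeylHeisenberg

/-! ### Trace norms of differences of spectral projections -/

section TraceNormBounds

open InnerProductSpace

variable {H : Type*} [NormedAddCommGroup H] [InnerProductSpace ℂ H]

/-! Renormalization is a unitary involution that carries the short-time Fourier transforms V_{h_r}
h_j to W_{j,r}(z) = H_{j,r}(z, z̄) exp(-π|z|²/2) (`hermiteWigner_eq`). A rotation by c multiplies
W_{j,r} by c^j c̄^r, so for fixed r these functions are orthogonal on every disk. Since the kernel
of the projection onto the range expands in them (`hasSum_whInfiniteKernel`), the Toeplitz operator
M of the disk D is diagonal in this basis, with eigenvalues mu_j = ∫_D |V_{h_r} h_j|². They are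
positive and summable, so they can be sorted; this gives the eigen-expansion.

For the comparison, both kernels belong to projections of rank N onto eigenvectors of one positive
contraction: P uses the N largest eigenvalues, Q the indices j < N. Compare each with M. The trace
distance of Q to M is N + tr M - 2 ∑_{j<N} mu_j, and by Ky Fan's principle that of P is no larger
(`traceNorm_projDiff_le`). Here tr M = |D| and N - |D| < 1, so everything reduces to the tail
∑_{j≥N} mu_j. No monotonicity of mu_j in j is needed, and any eigen-expansion is allowed.

For the tail, fix z. The numbers |W_{j,r}(z)|² form a probability distribution in j
(`hasSum_norm_sq_hermiteWigner`). Multiplication by j - π|z|² moves W_{j,r} only to the levels r and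
r ± 1 (`hermiteWigner_three_term`), so the second moment about π|z|² is O_r(1 + |z|²). A Chebyshev
estimate, integrated over the disk in polar coordinates, bounds the tail by a multiple of √N
(`toeplitzEigenvalue_tail_le`).

The explicit form of W, its addition formula, its orthonormality and the three-term relation all
come from two ladder relations, `hermiteWigner_succ_left` and `hermiteWigner_succ_right`. -/

theorem inner_mul_inner_self_eq (x y : H) :
    inner ℂ x y * inner ℂ y x = ((‖inner ℂ x y‖ ^ 2 : ℝ) : ℂ) := by
  rw [← inner_conj_symm y x, Complex.mul_conj, Complex.normSq_eq_norm_sq]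

/-- Since `T` takes values in `V`, expanding `T x` in an eigenbasis of the restriction determines
`T` on all of `H`; symmetry turns the coefficient ⟨e_i, T x⟩ into t_i ⟨e_i, x⟩. -/
theorem exists_eigen_decomposition [CompleteSpace H] (T : H →L[ℂ] H)
    (hT : (T : H →ₗ[ℂ] H).IsSymmetric)
    (V : Submodule ℂ H) [FiniteDimensional ℂ V] (hV : ∀ x, T x ∈ V) :
    ∃ (n : ℕ) (e : Fin n → H) (t : Fin n → ℝ), Orthonormal ℂ e ∧
      T = ∑ i, (t i : ℂ) • rankOne ℂ (e i) (e i) := by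
  have hinv : ∀ v ∈ V, (T : H →ₗ[ℂ] H) v ∈ V := fun v _ => hV v
  have hS := hT.restrict_invariant hinv
  let b := hS.eigenvectorBasis rfl
  have hev : ∀ i, T (b i : H) = (hS.eigenvalues rfl i : ℂ) • (b i : H) := fun i =>
    congrArg (Subtype.val) (hS.apply_eigenvectorBasis rfl i)
  refine ⟨_, fun i => (b i : H), fun i => hS.eigenvalues rfl i, ?_, ?_⟩
  · exact b.orthonormal.comp_linearIsometry V.subtypeₗᵢ
  · ext x
    have h := congrArg Subtype.val (b.sum_repr' ⟨T x, hV x⟩)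
    rw [Submodule.coe_sum] at h
    simp only [Submodule.coe_smul, Submodule.coe_inner] at h
    rw [← h]
    simp only [_root_.sum_apply, _root_.smul_apply, rankOne_apply]
    refine Finset.sum_congr rfl fun i _ => ?_
    have : inner ℂ (b i : H) (T x) = (hS.eigenvalues rfl i : ℂ) * inner ℂ (b i : H) x := by
      have := hT (b i : H) x
      simp only [ContinuousLinearMap.coe_coe] at this
      rw [← this, hev, inner_smul_left]
      simp
    rw [this, smul_smul]

theorem sum_smul_rankOne_mul_self {n : ℕ} {e : Fin n → H} (he : Orthonormal ℂ e)
    (t : Fin n → ℝ) :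
    (∑ i, (t i : ℂ) • rankOne ℂ (e i) (e i)) * (∑ i, (t i : ℂ) • rankOne ℂ (e i) (e i)) =
      ∑ i, ((t i * t i : ℝ) : ℂ) • rankOne ℂ (e i) (e i) := by
  ext x
  simp only [mul_apply_eq_comp, _root_.sum_apply, _root_.smul_apply, rankOne_apply,
    inner_sum, inner_smul_right, orthonormal_iff_ite.mp he]
  refine Finset.sum_congr rfl fun i _ => ?_
  simp [smul_smul, mul_assoc]

theorem re_inner_sum_smul_rankOne {n : ℕ} (e : Fin n → H) (t : Fin n → ℝ) (x : H) :
    RCLike.re (inner ℂ x ((∑ i, (t i : ℂ) • rankOne ℂ (e i) (e i)) x)) =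
      ∑ i, t i * ‖inner ℂ x (e i)‖ ^ 2 := by
  simp only [_root_.sum_apply, _root_.smul_apply, rankOne_apply, inner_sum, inner_smul_right,
    map_sum]
  refine Finset.sum_congr rfl fun i _ => ?_
  rw [mul_comm (inner ℂ (e i) x), inner_mul_inner_self_eq, ← Complex.ofReal_mul]
  exact Complex.ofReal_re _

theorem summable_mul_norm_inner_sq {ι : Type*} {q : ι → H} (hq : ∀ k, ‖q k‖ = 1) {c : ι → ℝ}
    (hc0 : ∀ k, 0 ≤ c k) (hc : Summable c) (x : H) :
    Summable fun k => c k * ‖inner ℂ (q k) x‖ ^ 2 := by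
  refine Summable.of_nonneg_of_le (fun k => mul_nonneg (hc0 k) (sq_nonneg _)) (fun k => ?_)
    (hc.mul_right (‖x‖ ^ 2))
  refine mul_le_mul_of_nonneg_left ?_ (hc0 k)
  have h := norm_inner_le_norm (𝕜 := ℂ) (q k) x
  rw [hq, one_mul] at h
  gcongr

/-- Interchange the sums and apply Bessel's inequality to each `q k` against `e`. The `q k` need
only be unit vectors. -/
theorem sum_tsum_mul_norm_inner_sq_le {ι κ : Type*} {q : ι → H} (hq : ∀ k, ‖q k‖ = 1) {c : ι → ℝ}
    (hc0 : ∀ k, 0 ≤ c k) (hc : Summable c) {e : κ → H} (he : Orthonormal ℂ e) (s : Finset κ) :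
    ∑ i ∈ s, ∑' k, c k * ‖inner ℂ (q k) (e i)‖ ^ 2 ≤ ∑' k, c k := by
  rw [← Summable.tsum_finsetSum fun i _ => summable_mul_norm_inner_sq hq hc0 hc (e i)]
  refine Summable.tsum_le_tsum (fun k => ?_)
    (summable_sum fun i _ => summable_mul_norm_inner_sq hq hc0 hc (e i)) hc
  rw [← Finset.mul_sum]
  refine mul_le_of_le_one_right (hc0 k) ?_
  have h := he.sum_inner_products_le (q k) (s := s)
  simp only [hq, one_pow] at h
  simpa only [norm_inner_symm] using h

/-- The rank one projections onto the first `N` vectors of two sequences, subtracted. -/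
noncomputable def projDiff (p q : ℕ → H) (N : ℕ) : H →L[ℂ] H :=
  ∑ j ∈ Finset.range N, rankOne ℂ (p j) (p j) - ∑ j ∈ Finset.range N, rankOne ℂ (q j) (q j)

theorem projDiff_mem_span (p q : ℕ → H) (N : ℕ) (x : H) :
    projDiff p q N x ∈ Submodule.span ℂ
      (p '' Set.Iio N ∪ q '' Set.Iio N) := by
  simp only [projDiff, _root_.sub_apply, _root_.sum_apply, rankOne_apply]
  refine Submodule.sub_mem _ ?_ ?_ <;> refine Submodule.sum_mem _ fun j hj => ?_ <;>
    refine Submodule.smul_mem _ _ (Submodule.subset_span ?_)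
  · exact Or.inl ⟨j, Finset.mem_range.mp hj, rfl⟩
  · exact Or.inr ⟨j, Finset.mem_range.mp hj, rfl⟩

theorem re_inner_projDiff (p q : ℕ → H) (N : ℕ) (x : H) :
    RCLike.re (inner ℂ x (projDiff p q N x)) =
      ∑ j ∈ Finset.range N, ‖inner ℂ (p j) x‖ ^ 2 - ∑ j ∈ Finset.range N, ‖inner ℂ (q j) x‖ ^ 2 := by
  have (v : H) : RCLike.re (inner ℂ v x * inner ℂ x v) = ‖inner ℂ v x‖ ^ 2 := by
    rw [inner_mul_inner_self_eq]
    exact Complex.ofReal_re _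
  simp only [projDiff, _root_.sub_apply, _root_.sum_apply, rankOne_apply, inner_sub_right,
    inner_sum, inner_smul_right, map_sub, map_sum, this]

variable [CompleteSpace H]

theorem star_sum_smul_rankOne {n : ℕ} (e : Fin n → H) (t : Fin n → ℝ) :
    star (∑ i, (t i : ℂ) • rankOne ℂ (e i) (e i)) = ∑ i, (t i : ℂ) • rankOne ℂ (e i) (e i) := by
  simp only [star_sum, star_smul, ContinuousLinearMap.star_eq_adjoint, adjoint_rankOne]
  simp

theorem sum_smul_rankOne_nonneg {n : ℕ} (e : Fin n → H) {t : Fin n → ℝ} (ht : ∀ i, 0 ≤ t i) :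
    0 ≤ ∑ i, (t i : ℂ) • rankOne ℂ (e i) (e i) := by
  rw [ContinuousLinearMap.nonneg_iff_isPositive, ContinuousLinearMap.isPositive_def']
  refine ⟨star_sum_smul_rankOne e t, fun x => ?_⟩
  rw [ContinuousLinearMap.reApplyInnerSelf_apply, ← inner_re_symm, re_inner_sum_smul_rankOne]
  exact Finset.sum_nonneg fun i _ => mul_nonneg (ht i) (sq_nonneg _)

theorem abs_sum_smul_rankOne {n : ℕ} {e : Fin n → H} (he : Orthonormal ℂ e) (t : Fin n → ℝ) :
    CFC.abs (∑ i, (t i : ℂ) • rankOne ℂ (e i) (e i)) =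
      ∑ i, ((|t i| : ℝ) : ℂ) • rankOne ℂ (e i) (e i) := by
  refine CFC.sqrt_unique ?_ (sum_smul_rankOne_nonneg e fun i => abs_nonneg (t i))
  rw [star_sum_smul_rankOne, sum_smul_rankOne_mul_self he, sum_smul_rankOne_mul_self he]
  simp only [abs_mul_abs_self]

/-- Bessel's inequality for each `e k` against the basis chosen inside `positiveTrace` already gives
this direction, so independence of the trace from the basis is never needed. -/
theorem traceNorm_sum_smul_rankOne_le {n : ℕ} {e : Fin n → H} (he : Orthonormal ℂ e)
    (t : Fin n → ℝ) :
    traceNorm (∑ i, (t i : ℂ) • rankOne ℂ (e i) (e i)) ≤ ENNReal.ofReal (∑ i, |t i|) := by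
  rw [traceNorm, abs_sum_smul_rankOne he, positiveTrace]
  simp only [re_inner_sum_smul_rankOne]
  generalize hb : (exists_hilbertBasis ℂ H).choose_spec.choose = b
  have h1 : ∀ i, ENNReal.ofReal (∑ k, |t k| * ‖inner ℂ (b i) (e k)‖ ^ 2) =
      ∑ k, ENNReal.ofReal (|t k|) * ENNReal.ofReal (‖inner ℂ (b i) (e k)‖ ^ 2) := fun i => by
    rw [ENNReal.ofReal_sum_of_nonneg fun k _ => mul_nonneg (abs_nonneg _) (sq_nonneg _)]
    exact Finset.sum_congr rfl fun k _ => ENNReal.ofReal_mul (abs_nonneg _)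
  simp only [h1]
  rw [Summable.tsum_finsetSum fun _ _ => ENNReal.summable,
    ENNReal.ofReal_sum_of_nonneg fun _ _ => abs_nonneg _]
  refine Finset.sum_le_sum fun k _ => ?_
  rw [ENNReal.tsum_mul_left]
  refine mul_le_of_le_one_right zero_le ?_
  rw [← ENNReal.ofReal_tsum_of_nonneg (fun _ => sq_nonneg _)
    (b.orthonormal.inner_products_summable (e k))]
  refine ENNReal.ofReal_le_one.mpr ((b.orthonormal.tsum_inner_products_le (e k)).trans ?_)
  simp [he.1 k]

/-- A finite-rank symmetric operator whose quadratic form is dominated by that of a positive trace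
class operator has trace norm at most the trace of the latter. -/
theorem traceNorm_le_of_quadratic_form (T : H →L[ℂ] H) (hT : (T : H →ₗ[ℂ] H).IsSymmetric)
    (V : Submodule ℂ H) [FiniteDimensional ℂ V] (hV : ∀ x, T x ∈ V)
    {p q : ℕ → H} (hp : ∀ k, ‖p k‖ = 1) (hq : ∀ k, ‖q k‖ = 1) {c d : ℕ → ℝ}
    (hc0 : ∀ k, 0 ≤ c k) (hd0 : ∀ k, 0 ≤ d k) (hc : Summable c) (hd : Summable d)
    (h : ∀ x, |RCLike.re (inner ℂ x (T x))| ≤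
      ∑' k, c k * ‖inner ℂ (p k) x‖ ^ 2 + ∑' k, d k * ‖inner ℂ (q k) x‖ ^ 2) :
    traceNorm T ≤ ENNReal.ofReal (∑' k, c k + ∑' k, d k) := by
  obtain ⟨n, e, t, he, rfl⟩ := exists_eigen_decomposition T hT V hV
  refine (traceNorm_sum_smul_rankOne_le he t).trans (ENNReal.ofReal_le_ofReal ?_)
  -- The eigenvalue `t i` is the value of the quadratic form at the unit eigenvector `e i`.
  have ht : ∀ i, |t i| ≤ ∑' k, c k * ‖inner ℂ (p k) (e i)‖ ^ 2 +
      ∑' k, d k * ‖inner ℂ (q k) (e i)‖ ^ 2 := fun i => by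
    refine le_trans (le_of_eq ?_) (h (e i))
    rw [re_inner_sum_smul_rankOne, Finset.sum_eq_single i]
    · simp [he.1 i]
    · intro j _ hj
      simp [he.2 hj.symm]
    · simp
  refine (Finset.sum_le_sum fun i _ => ht i).trans ?_
  rw [Finset.sum_add_distrib]
  exact add_le_add (sum_tsum_mul_norm_inner_sq_le hp hc0 hc he _)
    (sum_tsum_mul_norm_inner_sq_le hq hd0 hd he _)

/-- Ky Fan's maximum principle for weights: averages of an antitone sequence against weights in
`[0, 1]` of total mass at most `N` do not exceed the sum of the first `N` terms. -/
theorem tsum_mul_le_sum_range {lam w : ℕ → ℝ} (hlam : Antitone lam) (h0 : ∀ j, 0 ≤ lam j)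
    (hw0 : ∀ j, 0 ≤ w j) (hw1 : ∀ j, w j ≤ 1) (N : ℕ)
    (hw : ∀ m, ∑ j ∈ Finset.range m, w j ≤ N) (hs : Summable fun j => lam j * w j) :
    ∑' j, lam j * w j ≤ ∑ j ∈ Finset.range N, lam j := by
  refine hs.tsum_le_of_sum_range_le fun m => ?_
  -- Padding to `N + m` terms lets the sum be split at `N`. Beyond `N` the values are at most `lam
  -- N`, below it they are at least `lam N`; after both comparisons only the total mass of the
  -- weights matters.
  have hm : ∑ j ∈ Finset.range m, lam j * w j ≤ ∑ j ∈ Finset.range (N + m), lam j * w j :=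
    Finset.sum_le_sum_of_subset_of_nonneg (Finset.range_mono (by omega))
      fun j _ _ => mul_nonneg (h0 j) (hw0 j)
  refine hm.trans ?_
  have hwN := hw (N + m)
  rw [Finset.sum_range_add] at hwN ⊢
  have h1 : ∑ x ∈ Finset.range m, lam (N + x) * w (N + x) ≤
      lam N * ∑ x ∈ Finset.range m, w (N + x) := by
    rw [Finset.mul_sum]
    exact Finset.sum_le_sum fun x _ => mul_le_mul_of_nonneg_right (hlam (by omega)) (hw0 _)
  have h2 : lam N * (N - ∑ j ∈ Finset.range N, w j) ≤
      ∑ j ∈ Finset.range N, (lam j - lam j * w j) := by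
    have : (N : ℝ) - ∑ j ∈ Finset.range N, w j = ∑ j ∈ Finset.range N, (1 - w j) := by simp
    rw [this, Finset.mul_sum]
    refine Finset.sum_le_sum fun j hj => ?_
    have := mul_le_mul_of_nonneg_right (hlam (Finset.mem_range.mp hj).le) (sub_nonneg.mpr (hw1 j))
    linarith
  rw [Finset.sum_sub_distrib] at h2
  have h3 := mul_le_mul_of_nonneg_left hwN (h0 N)
  linarith

theorem projDiff_isSymmetric (p q : ℕ → H) (N : ℕ) :
    (projDiff p q N : H →ₗ[ℂ] H).IsSymmetric := by
  rw [← ContinuousLinearMap.isSelfAdjoint_iff_isSymmetric, isSelfAdjoint_iff, projDiff]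
  simp only [star_sub, star_sum, ContinuousLinearMap.star_eq_adjoint, adjoint_rankOne]

/-- With a_j = |⟨p_j, x⟩|² this compares the quadratic forms of the projection P and of M: P - M is
diagonal with entries 1_{j<N} - lam_j, and the right side is the form of its absolute value. -/
theorem abs_sum_range_sub_tsum_le {a lam : ℕ → ℝ} (ha : ∀ j, 0 ≤ a j) (h0 : ∀ j, 0 ≤ lam j)
    (h1 : ∀ j, lam j ≤ 1) (N : ℕ) (hs : Summable fun j => lam j * a j) :
    |∑ j ∈ Finset.range N, a j - ∑' j, lam j * a j| ≤
      ∑' j, (if j < N then 1 - lam j else lam j) * a j := by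
  have hf : Summable fun j => (if j < N then a j else 0) :=
    summable_of_ne_finset_zero (s := Finset.range N) fun j hj => by
      simp [Finset.mem_range] at hj; simp [hj]
  have hsum : ∑ j ∈ Finset.range N, a j = ∑' j, (if j < N then a j else 0) := by
    rw [tsum_eq_sum (s := Finset.range N) fun j hj => by
      simp [Finset.mem_range] at hj; simp [hj]]
    exact Finset.sum_congr rfl fun j hj => by simp [Finset.mem_range.mp hj]
  have heq : ∀ j, |(if j < N then a j else 0) - lam j * a j| =
      (if j < N then 1 - lam j else lam j) * a j := fun j => by
    split_ifs
    · rw [← one_sub_mul, abs_of_nonneg (mul_nonneg (sub_nonneg.mpr (h1 j)) (ha j))]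
    · rw [zero_sub, abs_neg, abs_of_nonneg (mul_nonneg (h0 j) (ha j))]
  rw [hsum, ← hf.tsum_sub hs]
  simp only [← heq]
  rw [← Real.norm_eq_abs]
  exact norm_tsum_le_tsum_norm (hf.sub hs).norm

theorem tsum_ite_one_sub {lam : ℕ → ℝ} (hs : Summable lam) (N : ℕ) :
    Summable (fun j => if j < N then 1 - lam j else lam j) ∧
    ∑' j, (if j < N then 1 - lam j else lam j) =
      N + ∑' j, lam j - 2 * ∑ j ∈ Finset.range N, lam j := by
  -- The weight is `lam j` plus the finitely supported correction 1 - 2 `lam j` for j < N.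
  have hf : HasSum (fun j => if j < N then 1 - 2 * lam j else 0)
      (∑ j ∈ Finset.range N, if j < N then 1 - 2 * lam j else 0) :=
    hasSum_sum_of_ne_finset_zero fun j hj => by simp [Finset.mem_range] at hj; simp [hj]
  have h := hf.add hs.hasSum
  have heq : (fun j => (if j < N then 1 - 2 * lam j else 0) + lam j) =
      fun j => if j < N then 1 - lam j else lam j := by
    ext j; split_ifs <;> ring
  rw [heq] at h
  refine ⟨h.summable, h.tsum_eq.trans ?_⟩
  have : (∑ j ∈ Finset.range N, if j < N then 1 - 2 * lam j else 0) =
      ∑ j ∈ Finset.range N, (1 - 2 * lam j) :=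
    Finset.sum_congr rfl fun j hj => by simp [Finset.mem_range.mp hj]
  rw [this, Finset.sum_sub_distrib, ← Finset.mul_sum]
  simp
  ring

/-- If two orthonormal sequences diagonalize the same positive contraction, the first one in
non-increasing order of the eigenvalues, then the projections onto their first `N` members differ
in trace norm by at most twice the distance of the second projection to the operator. -/
theorem traceNorm_projDiff_le {p q : ℕ → H} (hp : Orthonormal ℂ p) (hq : Orthonormal ℂ q)
    {lam mu : ℕ → ℝ} (hlam : Antitone lam) (hlam0 : ∀ j, 0 ≤ lam j) (hmu0 : ∀ j, 0 ≤ mu j)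
    (hmu1 : ∀ j, mu j ≤ 1) (hmu : Summable mu) (Q : H → ℝ)
    (hQp : ∀ x, HasSum (fun j => lam j * ‖inner ℂ (p j) x‖ ^ 2) (Q x))
    (hQq : ∀ x, HasSum (fun j => mu j * ‖inner ℂ (q j) x‖ ^ 2) (Q x)) (N : ℕ) :
    traceNorm (projDiff p q N) ≤
      ENNReal.ofReal (2 * (N + ∑' j, mu j - 2 * ∑ j ∈ Finset.range N, mu j)) := by
  have hQpj : ∀ j, Q (p j) = lam j := fun j => by
    refine (hQp (p j)).unique ?_
    have := hasSum_single (f := fun k => lam k * ‖inner ℂ (p k) (p j)‖ ^ 2) j fun k hk => by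
      simp [hp.2 hk]
    simpa [hp.1 j] using this
  have hQqj : ∀ j, Q (q j) = mu j := fun j => by
    refine (hQq (q j)).unique ?_
    have := hasSum_single (f := fun k => mu k * ‖inner ℂ (q k) (q j)‖ ^ 2) j fun k hk => by
      simp [hq.2 hk]
    simpa [hq.1 j] using this
  -- The diagonal values Q(p_j) sum to at most the trace computed from `q`. This yields summability
  -- of `lam`, which is not assumed.
  have hsumlam : ∀ s : Finset ℕ, ∑ j ∈ s, lam j ≤ ∑' j, mu j := fun s => by
    have := sum_tsum_mul_norm_inner_sq_le hq.1 hmu0 hmu hp s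
    simpa only [(hQq _).tsum_eq, hQpj] using this
  have hlams : Summable lam := summable_of_sum_range_le hlam0 fun n => hsumlam _
  have hlamle : ∑' j, lam j ≤ ∑' j, mu j := hlams.tsum_le_of_sum_range_le fun n => hsumlam _
  have hlam1 : ∀ j, lam j ≤ 1 := fun j => by
    rw [← hQpj j, ← (hQq (p j)).tsum_eq]
    refine (Summable.tsum_le_tsum (fun k => mul_le_of_le_one_left (sq_nonneg _) (hmu1 k))
      (hQq (p j)).summable (hq.inner_products_summable (p j))).trans ?_
    refine (hq.tsum_inner_products_le (p j)).trans ?_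
    simp [hp.1 j]
  -- Ky Fan: the left side is ∑_{j<N} Q(q_j), an average of `lam` with weights ∑_{j<N} |⟨p_k,
  -- q_j⟩|². Bessel in `q` bounds each weight by 1, Bessel in `p` bounds their total by N.
  have hKF : ∑ j ∈ Finset.range N, mu j ≤ ∑ j ∈ Finset.range N, lam j := by
    have h1 : ∑ j ∈ Finset.range N, mu j =
        ∑' k, lam k * ∑ j ∈ Finset.range N, ‖inner ℂ (p k) (q j)‖ ^ 2 := by
      simp only [Finset.mul_sum]
      rw [Summable.tsum_finsetSum fun j _ => (hQp (q j)).summable]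
      exact Finset.sum_congr rfl fun j _ => by rw [(hQp (q j)).tsum_eq, hQqj]
    rw [h1]
    refine tsum_mul_le_sum_range hlam hlam0 (fun k => Finset.sum_nonneg fun _ _ => sq_nonneg _)
      (fun k => ?_) N (fun m => ?_) ?_
    · have := hq.sum_inner_products_le (p k) (s := Finset.range N)
      simpa only [norm_inner_symm, hp.1, one_pow] using this
    · rw [Finset.sum_comm]
      refine (Finset.sum_le_sum fun j _ => hp.sum_inner_products_le (q j)).trans ?_
      simp [hq.1]
    · simp only [Finset.mul_sum]
      exact summable_sum fun j _ => (hQp (q j)).summable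
  obtain ⟨hcs, hct⟩ := tsum_ite_one_sub hlams N
  obtain ⟨hds, hdt⟩ := tsum_ite_one_sub hmu N
  have : FiniteDimensional ℂ (Submodule.span ℂ (p '' Set.Iio N ∪ q '' Set.Iio N)) :=
    FiniteDimensional.span_of_finite ℂ
      (((Set.finite_Iio N).image p).union ((Set.finite_Iio N).image q))
  -- The triangle inequality through the common form Q is applied to quadratic forms, so no triangle
  -- inequality for the trace norm is required.
  have key := traceNorm_le_of_quadratic_form (projDiff p q N) (projDiff_isSymmetric p q N) _
    (projDiff_mem_span p q N) hp.1 hq.1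
    (c := fun j => if j < N then 1 - lam j else lam j)
    (d := fun j => if j < N then 1 - mu j else mu j)
    (fun k => by split_ifs; exacts [sub_nonneg.mpr (hlam1 k), hlam0 k])
    (fun k => by split_ifs; exacts [sub_nonneg.mpr (hmu1 k), hmu0 k]) hcs hds (fun x => by
      rw [re_inner_projDiff]
      have h1 := abs_sum_range_sub_tsum_le (a := fun j => ‖inner ℂ (p j) x‖ ^ 2)
        (fun _ => sq_nonneg _) hlam0 hlam1 N (hQp x).summable
      have h2 := abs_sum_range_sub_tsum_le (a := fun j => ‖inner ℂ (q j) x‖ ^ 2)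
        (fun _ => sq_nonneg _) hmu0 hmu1 N (hQq x).summable
      rw [(hQp x).tsum_eq] at h1
      rw [(hQq x).tsum_eq, abs_sub_comm] at h2
      refine le_trans ?_ (add_le_add h1 h2)
      refine le_trans (le_of_eq ?_) (abs_add_le _ _)
      congr 1
      ring)
  refine key.trans (ENNReal.ofReal_le_ofReal ?_)
  -- The share of `p` does not exceed that of `q`: by `hlamle` its total is smaller, by `hKF` its
  -- first N terms are larger. Hence the factor 2.
  rw [hct, hdt]
  linarith

end TraceNormBounds

/-! ### Hermite functions: ladder relations and decay -/

section HermiteFunctions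

open Polynomial

theorem derivative_hermite (n : ℕ) :
    derivative (hermite n) = (n : ℤ[X]) * hermite (n - 1) := by
  induction n with
  | zero => simp
  | succ n ih =>
    rw [hermite_succ, derivative_sub, derivative_mul, derivative_X, ih]
    cases n with
    | zero => simp
    | succ n =>
      rw [derivative_mul, derivative_natCast, Nat.add_sub_cancel, Nat.add_sub_cancel,
        hermite_succ n]
      push_cast
      ring

/-- The (real-valued) Hermite functions. -/
noncomputable def hermiteReal (r : ℕ) (t : ℝ) : ℝ :=
  (2 : ℝ) ^ (1 / 4 : ℝ) / √(r ! : ℝ) * aeval (2 * √Real.pi * t) (hermite r) *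
    Real.exp (-Real.pi * t ^ 2)

/-- Under y = 2√π t the Gaussian becomes exp(-y²/2), and Rodrigues' formula for the probabilists'
Hermite polynomials applies; the powers of 2√π and of -1 cancel the normalization. -/
theorem hermiteFun_eq (r : ℕ) (t : ℝ) : hermiteFun r t = (hermiteReal r t : ℂ) := by
  have h1 : iteratedDeriv r (fun s : ℝ => Real.exp (-2 * Real.pi * s ^ 2)) t =
      (2 * √Real.pi) ^ r * ((-1) ^ r * aeval (2 * √Real.pi * t) (hermite r) *
        Real.exp (-2 * Real.pi * t ^ 2)) := by
    have hsq : ∀ s : ℝ, -2 * Real.pi * s ^ 2 = -((2 * √Real.pi * s) ^ 2 / 2) := fun s => by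
      rw [mul_pow, mul_pow, Real.sq_sqrt Real.pi_pos.le]; ring
    have h := congrFun (iteratedDeriv_comp_const_mul (n := r)
      (f := fun y : ℝ => Real.exp (-(y ^ 2 / 2))) (by fun_prop) (2 * √Real.pi)) t
    simp only [hsq]
    rw [h, iteratedDeriv_eq_iterate, deriv_gaussian_eq_hermite_mul_gaussian]
  have h2 : Real.exp (Real.pi * t ^ 2) * Real.exp (-2 * Real.pi * t ^ 2) =
      Real.exp (-Real.pi * t ^ 2) := by rw [← Real.exp_add]; ring_nf
  have h3 : (-1 / (2 * √Real.pi)) ^ r * (2 * √Real.pi) ^ r * (-1) ^ r = 1 := by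
    rw [← mul_pow, ← mul_pow]
    have : √Real.pi ≠ 0 := (Real.sqrt_pos.mpr Real.pi_pos).ne'
    have : -1 / (2 * √Real.pi) * (2 * √Real.pi) * -1 = 1 := by field_simp
    rw [this, one_pow]
  rw [hermiteFun, h1, hermiteReal, ← h2]
  congr 1
  linear_combination ((2 : ℝ) ^ (1 / 4 : ℝ) / √(r ! : ℝ) * aeval (2 * √Real.pi * t) (hermite r) *
    (Real.exp (Real.pi * t ^ 2) * Real.exp (-2 * Real.pi * t ^ 2))) * h3

theorem sqrt_factorial_succ (r : ℕ) : √((r + 1)! : ℝ) = √(r + 1 : ℝ) * √(r ! : ℝ) := by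
  rw [Nat.factorial_succ, Nat.cast_mul, Real.sqrt_mul (by positivity), Nat.cast_succ]

theorem hasDerivAt_hermiteReal (r : ℕ) (t : ℝ) :
    HasDerivAt (hermiteReal r)
      (2 * Real.pi * t * hermiteReal r t - 2 * √Real.pi * (√(r + 1) * hermiteReal (r + 1) t)) t := by
  have h1 : HasDerivAt (fun t : ℝ => aeval (2 * √Real.pi * t) (hermite r))
      (aeval (2 * √Real.pi * t) (derivative (hermite r)) * (2 * √Real.pi)) t := by
    have := ((hermite r).hasDerivAt_aeval (2 * √Real.pi * t)).comp t
      ((hasDerivAt_id t).const_mul (2 * √Real.pi))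
    simpa [Function.comp_def] using this
  have h2 : HasDerivAt (fun t : ℝ => Real.exp (-Real.pi * t ^ 2))
      (Real.exp (-Real.pi * t ^ 2) * (-Real.pi * (2 * t))) t := by
    have := (((hasDerivAt_id t).pow 2).const_mul (-Real.pi)).exp
    simpa using this
  have h3 := ((h1.const_mul ((2 : ℝ) ^ (1 / 4 : ℝ) / √(r ! : ℝ))).mul h2)
  convert! h3 using 1
  have hd : aeval (2 * √Real.pi * t) (derivative (hermite r)) =
      2 * √Real.pi * t * aeval (2 * √Real.pi * t) (hermite r) -
        aeval (2 * √Real.pi * t) (hermite (r + 1)) := by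
    rw [hermite_succ]; simp
  have hs : √(r + 1 : ℝ) ≠ 0 := (Real.sqrt_pos.mpr (by positivity)).ne'
  have hf : √(r ! : ℝ) ≠ 0 := (Real.sqrt_pos.mpr (by positivity)).ne'
  have hp : √Real.pi * √Real.pi = Real.pi := Real.mul_self_sqrt Real.pi_pos.le
  rw [hd, hermiteReal, hermiteReal, sqrt_factorial_succ]
  generalize aeval (2 * √Real.pi * t) (hermite r) = A
  generalize aeval (2 * √Real.pi * t) (hermite (r + 1)) = B
  field_simp
  linear_combination (-2 * t * A) * hp

/-- This is He_{r+1} = X He_r - r He_{r-1}. For r = 0 the truncated index `r - 1` is harmless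
because its coefficient √0 vanishes; all ladder relations below rely on this convention. -/
theorem two_mul_sqrt_pi_mul_hermiteReal (r : ℕ) (t : ℝ) :
    √(r + 1) * hermiteReal (r + 1) t + √r * hermiteReal (r - 1) t =
      2 * √Real.pi * t * hermiteReal r t := by
  have hs : √(r + 1 : ℝ) ≠ 0 := (Real.sqrt_pos.mpr (by positivity)).ne'
  have hf : √(r ! : ℝ) ≠ 0 := (Real.sqrt_pos.mpr (by positivity)).ne'
  have h1 : √r * hermiteReal (r - 1) t = (2 : ℝ) ^ (1 / 4 : ℝ) / √(r ! : ℝ) *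
      aeval (2 * √Real.pi * t) (derivative (hermite r)) * Real.exp (-Real.pi * t ^ 2) := by
    rw [derivative_hermite]
    cases r with
    | zero => simp
    | succ r =>
      have hs : √(r + 1 : ℝ) ≠ 0 := (Real.sqrt_pos.mpr (by positivity)).ne'
      have hf : √(r ! : ℝ) ≠ 0 := (Real.sqrt_pos.mpr (by positivity)).ne'
      have hss : √(r + 1 : ℝ) * √(r + 1 : ℝ) = r + 1 := Real.mul_self_sqrt (by positivity)
      rw [Nat.add_sub_cancel, hermiteReal, sqrt_factorial_succ]
      simp only [map_mul, map_natCast]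
      generalize aeval (2 * √Real.pi * t) (hermite r) = A
      push_cast
      field_simp
      linear_combination A * hss
  rw [h1, hermiteReal, hermiteReal, sqrt_factorial_succ, hermite_succ]
  simp only [map_sub, map_mul, aeval_X]
  field_simp
  ring

theorem continuous_hermiteReal (r : ℕ) : Continuous (hermiteReal r) :=
  continuous_iff_continuousAt.mpr fun t => (hasDerivAt_hermiteReal r t).continuousAt

theorem integrable_polynomial_mul_gaussian (p : ℝ[X]) {b : ℝ} (hb : 0 < b) :
    Integrable fun t : ℝ => p.eval t * Real.exp (-b * t ^ 2) := by
  simp only [eval_eq_sum_range, Finset.sum_mul]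
  refine integrable_finsetSum _ fun i _ => ?_
  have := integrable_rpow_mul_exp_neg_mul_sq hb (s := i)
    (lt_of_lt_of_le (by norm_num) (Nat.cast_nonneg i))
  simp only [Real.rpow_natCast] at this
  simpa only [mul_assoc] using this.const_mul (p.coeff i)

theorem exists_polynomial_hermiteReal (r : ℕ) :
    ∃ p : ℝ[X], ∀ t, hermiteReal r t = p.eval t * Real.exp (-Real.pi * t ^ 2) := by
  refine ⟨C ((2 : ℝ) ^ (1 / 4 : ℝ) / √(r ! : ℝ)) *
    ((hermite r).map (Int.castRingHom ℝ)).comp (C (2 * √Real.pi) * X), fun t => ?_⟩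
  rw [hermiteReal]
  simp [aeval_def, eval₂_eq_eval_map, eval_comp]

theorem integrable_hermiteReal (r : ℕ) : Integrable (hermiteReal r) := by
  obtain ⟨p, hp⟩ := exists_polynomial_hermiteReal r
  rw [funext hp]
  exact integrable_polynomial_mul_gaussian p Real.pi_pos

theorem integrable_mul_hermiteReal (r : ℕ) : Integrable fun t => t * hermiteReal r t := by
  obtain ⟨p, hp⟩ := exists_polynomial_hermiteReal r
  have := integrable_polynomial_mul_gaussian (X * p) Real.pi_pos
  simpa [hp, mul_assoc] using this

/-- The derivative is integrable, so the fundamental theorem of calculus bounds the total variation.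
-/
theorem exists_bound_hermiteReal (r : ℕ) : ∃ C, ∀ t, ‖hermiteReal r t‖ ≤ C := by
  have h : Integrable (fun t => deriv (hermiteReal r) t) := by
    simp only [(hasDerivAt_hermiteReal r _).deriv]
    have h1 := (integrable_mul_hermiteReal r).const_mul (2 * Real.pi)
    simp only [← mul_assoc] at h1
    exact h1.sub (((integrable_hermiteReal (r + 1)).const_mul _).const_mul _)
  refine ⟨‖hermiteReal r 0‖ + ∫ t, ‖deriv (hermiteReal r) t‖, fun t => ?_⟩
  have hFTC : ∫ s in (0 : ℝ)..t, deriv (hermiteReal r) s = hermiteReal r t - hermiteReal r 0 :=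
    intervalIntegral.integral_deriv_eq_sub
      (fun s _ => (hasDerivAt_hermiteReal r s).differentiableAt) h.intervalIntegrable
  have h2 : ‖hermiteReal r t - hermiteReal r 0‖ ≤ ∫ t, ‖deriv (hermiteReal r) t‖ := by
    rw [← hFTC]
    exact (intervalIntegral.norm_integral_le_integral_norm_uIoc).trans
      (setIntegral_le_integral h.norm (Filter.Eventually.of_forall fun _ => norm_nonneg _))
  have h3 := norm_add_le (hermiteReal r 0) (hermiteReal r t - hermiteReal r 0)
  rw [add_sub_cancel] at h3
  linarith

theorem memLp_hermiteFun (r : ℕ) : MemLp (hermiteFun r) 2 volume := by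
  have h : MemLp (hermiteReal r) 2 volume := by
    rw [memLp_two_iff_integrable_sq (continuous_hermiteReal r).aestronglyMeasurable]
    obtain ⟨p, hp⟩ := exists_polynomial_hermiteReal r
    have := integrable_polynomial_mul_gaussian (p ^ 2) (mul_pos two_pos Real.pi_pos)
    refine this.congr (Filter.Eventually.of_forall fun t => ?_)
    simp only [hp, mul_pow, eval_pow]
    rw [← Real.exp_nat_mul]
    congr 2
    push_cast
    ring
  rw [funext (hermiteFun_eq r)]
  exact h.ofReal

end HermiteFunctions

/-! ### Ladder relations for the short-time Fourier transform -/

section ShortTimeFourier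

theorem stft_hermiteFun (j r : ℕ) (z : ℂ) :
    stft (hermiteFun r) (hermiteFun j) z =
      ∫ t : ℝ, (hermiteReal j t : ℂ) * (hermiteReal r (t - z.re) : ℂ) *
        cexp (-2 * Real.pi * I * z.im * t) := by
  simp only [stft, hermiteFun_eq, Complex.conj_ofReal]

theorem norm_cexp_stft (y t : ℝ) : ‖cexp (-2 * Real.pi * I * y * t)‖ = 1 := by
  have : (-2 * Real.pi * I * y * t : ℂ) = ((-2 * Real.pi * y * t : ℝ) : ℂ) * I := by
    push_cast; ring
  rw [this, Complex.norm_exp_ofReal_mul_I]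

theorem integrable_stft_integrand (j r : ℕ) (x y : ℝ) :
    Integrable fun t : ℝ => (hermiteReal j t : ℂ) * (hermiteReal r (t - x) : ℂ) *
      cexp (-2 * Real.pi * I * y * t) := by
  obtain ⟨C, hC⟩ := exists_bound_hermiteReal r
  have h1 : Integrable fun t : ℝ => (hermiteReal j t : ℂ) := (integrable_hermiteReal j).ofReal
  have hc := continuous_hermiteReal r
  simp only [mul_assoc]
  refine h1.mul_bdd (c := C) ?_ (Filter.Eventually.of_forall fun t => ?_)
  · refine Continuous.aestronglyMeasurable ?_
    fun_prop
  · rw [norm_mul, ← mul_assoc, ← mul_assoc, ← mul_assoc, norm_cexp_stft, mul_one, Complex.norm_real]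
    exact hC _

theorem integrable_sum_stft_integrand {n : ℕ} (c : Fin n → ℂ) (a b : Fin n → ℕ) (x y : ℝ) :
    Integrable fun t : ℝ => ∑ i, c i * ((hermiteReal (a i) t : ℂ) *
      (hermiteReal (b i) (t - x) : ℂ) * cexp (-2 * Real.pi * I * y * t)) :=
  integrable_finsetSum _ fun _ _ => (integrable_stft_integrand _ _ x y).const_mul _

/-- Collects several transforms under one integral, so that identities between Hermite functions
become pointwise identities of integrands. -/
theorem sum_mul_stft_hermiteFun {n : ℕ} (c : Fin n → ℂ) (a b : Fin n → ℕ) (z : ℂ) :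
    ∑ i, c i * stft (hermiteFun (b i)) (hermiteFun (a i)) z =
      ∫ t : ℝ, ∑ i, c i * ((hermiteReal (a i) t : ℂ) * (hermiteReal (b i) (t - z.re) : ℂ) *
        cexp (-2 * Real.pi * I * z.im * t)) := by
  rw [integral_finsetSum _ fun _ _ => (integrable_stft_integrand _ _ z.re z.im).const_mul _]
  simp only [stft_hermiteFun, integral_const_mul]

/-- The position recurrence is used for h_j at t and for h_r at t - x; the two multipliers differ by
a multiple of x, which leaves the integral. -/
theorem stft_hermiteFun_re (j r : ℕ) (z : ℂ) :
    √(j + 1) * stft (hermiteFun r) (hermiteFun (j + 1)) z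
      + √j * stft (hermiteFun r) (hermiteFun (j - 1)) z
      - √(r + 1) * stft (hermiteFun (r + 1)) (hermiteFun j) z
      - √r * stft (hermiteFun (r - 1)) (hermiteFun j) z =
    2 * √Real.pi * z.re * stft (hermiteFun r) (hermiteFun j) z := by
  have h := sum_mul_stft_hermiteFun ![(√(j + 1) : ℂ), √j, -√(r + 1), -√r,
    -(2 * √Real.pi * z.re)] ![j + 1, j - 1, j, j, j] ![r, r, r + 1, r - 1, r] z
  simp only [Fin.sum_univ_succ, Fin.sum_univ_zero, Matrix.cons_val_zero, Matrix.cons_val_succ] at h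
  have h0 : ∀ t : ℝ, √(j + 1) * ((hermiteReal (j + 1) t : ℂ) * (hermiteReal r (t - z.re) : ℂ) *
        cexp (-2 * Real.pi * I * z.im * t)) + (√j * ((hermiteReal (j - 1) t : ℂ) *
        (hermiteReal r (t - z.re) : ℂ) * cexp (-2 * Real.pi * I * z.im * t)) +
        (-√(r + 1) * ((hermiteReal j t : ℂ) * (hermiteReal (r + 1) (t - z.re) : ℂ) *
        cexp (-2 * Real.pi * I * z.im * t)) + (-√r * ((hermiteReal j t : ℂ) *
        (hermiteReal (r - 1) (t - z.re) : ℂ) * cexp (-2 * Real.pi * I * z.im * t)) +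
        (-(2 * √Real.pi * z.re) * ((hermiteReal j t : ℂ) * (hermiteReal r (t - z.re) : ℂ) *
        cexp (-2 * Real.pi * I * z.im * t)) + 0)))) = 0 := fun t => by
    have h1 := congrArg (fun x : ℝ => (x : ℂ)) (two_mul_sqrt_pi_mul_hermiteReal j t)
    have h2 := congrArg (fun x : ℝ => (x : ℂ)) (two_mul_sqrt_pi_mul_hermiteReal r (t - z.re))
    push_cast at h1 h2
    linear_combination (hermiteReal r (t - z.re) : ℂ) * cexp (-2 * Real.pi * I * z.im * t) * h1 -
      (hermiteReal j t : ℂ) * cexp (-2 * Real.pi * I * z.im * t) * h2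
  simp only [h0, integral_zero] at h
  linear_combination h

/-- Integration by parts: the derivative of the integrand integrates to zero, and differentiating
the exponential produces ξ. -/
theorem stft_hermiteFun_im (j r : ℕ) (z : ℂ) :
    √j * stft (hermiteFun r) (hermiteFun (j - 1)) z
      - √(j + 1) * stft (hermiteFun r) (hermiteFun (j + 1)) z
      + √r * stft (hermiteFun (r - 1)) (hermiteFun j) z
      - √(r + 1) * stft (hermiteFun (r + 1)) (hermiteFun j) z =
    2 * I * √Real.pi * z.im * stft (hermiteFun r) (hermiteFun j) z := by
  have hderiv : ∀ t : ℝ, HasDerivAt (fun t : ℝ => (hermiteReal j t : ℂ) *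
      (hermiteReal r (t - z.re) : ℂ) * cexp (-2 * Real.pi * I * z.im * t)) _ t := fun t =>
    (((hasDerivAt_hermiteReal j t).ofReal_comp).mul
      ((hasDerivAt_hermiteReal r (t - z.re)).comp_sub_const t z.re).ofReal_comp).mul
      (((hasDerivAt_id t).ofReal_comp.const_mul (-2 * Real.pi * I * z.im)).cexp)
  have hp : (√Real.pi : ℂ) * √Real.pi = Real.pi := by
    exact_mod_cast Real.mul_self_sqrt Real.pi_pos.le
  have hint := integrable_sum_stft_integrand ![(√Real.pi * √j : ℂ), -(√Real.pi * √(j + 1)),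
    √Real.pi * √r, -(√Real.pi * √(r + 1)), -(2 * I * Real.pi * z.im)]
    ![j - 1, j + 1, j, j, j] ![r, r, r - 1, r + 1, r] z.re z.im
  have h := sum_mul_stft_hermiteFun ![(√Real.pi * √j : ℂ), -(√Real.pi * √(j + 1)),
    √Real.pi * √r, -(√Real.pi * √(r + 1)), -(2 * I * Real.pi * z.im)]
    ![j - 1, j + 1, j, j, j] ![r, r, r - 1, r + 1, r] z
  simp only [Fin.sum_univ_succ, Fin.sum_univ_zero, Matrix.cons_val_zero, Matrix.cons_val_succ]
    at h hint
  -- The position recurrence removes the explicit factors t, turning each h_n' into √π (√n h_{n-1} -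
  -- √(n+1) h_{n+1}).
  have heq : ∀ t : ℝ, _ = _ := fun t => (show _ = √Real.pi * √j * ((hermiteReal (j - 1) t : ℂ) *
        (hermiteReal r (t - z.re) : ℂ) *
        cexp (-2 * Real.pi * I * z.im * t)) + (-(√Real.pi * √(j + 1)) * ((hermiteReal (j + 1) t : ℂ) *
        (hermiteReal r (t - z.re) : ℂ) * cexp (-2 * Real.pi * I * z.im * t)) +
        (√Real.pi * √r * ((hermiteReal j t : ℂ) * (hermiteReal (r - 1) (t - z.re) : ℂ) *
        cexp (-2 * Real.pi * I * z.im * t)) + (-(√Real.pi * √(r + 1)) * ((hermiteReal j t : ℂ) *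
        (hermiteReal (r + 1) (t - z.re) : ℂ) * cexp (-2 * Real.pi * I * z.im * t)) +
        (-(2 * I * Real.pi * z.im) * ((hermiteReal j t : ℂ) * (hermiteReal r (t - z.re) : ℂ) *
        cexp (-2 * Real.pi * I * z.im * t)) + 0)))) by
    have h1 := congrArg (fun x : ℝ => (x : ℂ)) (two_mul_sqrt_pi_mul_hermiteReal j t)
    have h2 := congrArg (fun x : ℝ => (x : ℂ)) (two_mul_sqrt_pi_mul_hermiteReal r (t - z.re))
    push_cast at h1 h2
    refine HasDerivAt.unique (hderiv t) ?_
    convert! hderiv t using 1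
    simp only [Pi.mul_apply, id]
    push_cast
    linear_combination (√Real.pi : ℂ) * (hermiteReal r (t - z.re) : ℂ) *
      cexp (-2 * Real.pi * I * z.im * t) * h1 + (√Real.pi : ℂ) *
      (hermiteReal j t : ℂ) * cexp (-2 * Real.pi * I * z.im * t) * h2 +
      (2 * (2 * t - z.re) * (hermiteReal r (t - z.re) : ℂ) * (hermiteReal j t : ℂ) *
        cexp (-2 * Real.pi * I * z.im * t)) * hp)
  have h0 := integral_eq_zero_of_hasDerivAt_of_integrable (fun t => heq t ▸ hderiv t) hint
    (integrable_stft_integrand j r z.re z.im)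
  rw [h0] at h
  have h1 : (√Real.pi : ℂ) ≠ 0 := by
    exact_mod_cast (Real.sqrt_pos.mpr Real.pi_pos).ne'
  refine mul_left_cancel₀ h1 ?_
  linear_combination h - 2 * I * z.im * stft (hermiteFun r) (hermiteFun j) z * hp

end ShortTimeFourier

/-! ### Identification with the complex Hermite polynomials -/

section ComplexHermiteBasis

/-- The renormalized short-time Fourier transform of a Hermite function with Hermite window. -/
noncomputable def hermiteWigner (j r : ℕ) : ℂ → ℂ :=
  renormFun (stft (hermiteFun r) (hermiteFun j))

/-- Half the difference of the two transform identities at z̄, where x and iξ combine to z. Half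
their sum gives the companion relation in r, with z̄. -/
theorem hermiteWigner_succ_left (j r : ℕ) (z : ℂ) :
    √(j + 1) * hermiteWigner (j + 1) r z =
      √r * hermiteWigner j (r - 1) z + √Real.pi * z * hermiteWigner j r z := by
  have h1 := stft_hermiteFun_re j r (conj z)
  have h2 := stft_hermiteFun_im j r (conj z)
  simp only [Complex.conj_re, Complex.conj_im] at h1 h2
  push_cast at h2
  simp only [hermiteWigner, renormFun]
  linear_combination (cexp (-(Real.pi * I * (z.re * z.im))) / 2) * (h1 - h2) +
    cexp (-(Real.pi * I * (z.re * z.im))) * √Real.pi *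
      stft (hermiteFun r) (hermiteFun j) (conj z) * Complex.re_add_im z

theorem hermiteWigner_succ_right (j r : ℕ) (z : ℂ) :
    √(r + 1) * hermiteWigner j (r + 1) z =
      √j * hermiteWigner (j - 1) r z - √Real.pi * conj z * hermiteWigner j r z := by
  have h1 := stft_hermiteFun_re j r (conj z)
  have h2 := stft_hermiteFun_im j r (conj z)
  have hz : conj z = z.re - z.im * I := by
    apply Complex.ext <;> simp
  simp only [Complex.conj_re, Complex.conj_im] at h1 h2
  push_cast at h2
  simp only [hermiteWigner, renormFun]
  linear_combination (-cexp (-(Real.pi * I * (z.re * z.im))) / 2) * (h1 + h2) +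
    √Real.pi * cexp (-(Real.pi * I * (z.re * z.im))) *
      stft (hermiteFun r) (hermiteFun j) (conj z) * hz

theorem hermiteWigner_zero_zero (z : ℂ) :
    hermiteWigner 0 0 z = (Real.exp (-(Real.pi / 2) * ‖z‖ ^ 2) : ℂ) := by
  have h2 : ((2 : ℝ) ^ (1 / 4 : ℝ)) * (2 : ℝ) ^ (1 / 4 : ℝ) = √2 := by
    rw [← Real.rpow_add two_pos, Real.sqrt_eq_rpow]; norm_num
  have h : ∀ t : ℝ, (hermiteReal 0 t : ℂ) * (hermiteReal 0 (t - (conj z).re) : ℂ) *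
      cexp (-2 * Real.pi * I * (conj z).im * t) = (√2 : ℂ) *
      cexp ((-2 * Real.pi) * t ^ 2 + (2 * Real.pi * (z.re + I * z.im)) * t + (-Real.pi * z.re ^ 2)) :=
    fun t => by
    have h3 : (hermiteReal 0 t : ℂ) * (hermiteReal 0 (t - z.re) : ℂ) =
        √2 * (cexp (-Real.pi * t ^ 2) * cexp (-Real.pi * (t - z.re) ^ 2)) := by
      simp only [hermiteReal, Polynomial.hermite_zero, ← h2]
      push_cast
      simp
      ring
    rw [Complex.conj_re, h3, ← Complex.exp_add, mul_assoc, ← Complex.exp_add]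
    congr 2
    simp
    ring
  have hb : (-2 * Real.pi : ℂ).re < 0 := by simp [Real.pi_pos]
  have hs : (Real.pi / -(-2 * Real.pi) : ℂ) ^ (1 / 2 : ℂ) = ((√2)⁻¹ : ℝ) := by
    have h1 : (Real.pi / -(-2 * Real.pi) : ℂ) = ((1 / 2 : ℝ) : ℂ) := by
      have : (Real.pi : ℂ) ≠ 0 := by exact_mod_cast Real.pi_ne_zero
      push_cast; field_simp
    have h3 : (1 / 2 : ℂ) = ((1 / 2 : ℝ) : ℂ) := by push_cast; rfl
    rw [h1, h3, ← Complex.ofReal_cpow (by norm_num), ← Real.sqrt_eq_rpow]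
    simp
  have hs2 : (√2 : ℂ) ≠ 0 := by
    exact_mod_cast (Real.sqrt_pos.mpr two_pos).ne'
  rw [hermiteWigner, renormFun, stft_hermiteFun]
  simp only [h]
  rw [integral_const_mul, integral_cexp_quadratic hb, hs]
  push_cast
  rw [← mul_assoc (√2 : ℂ), mul_inv_cancel₀ hs2, one_mul, ← Complex.exp_add]
  congr 1
  have hn : ((‖z‖ : ℂ)) ^ 2 = z.re ^ 2 + z.im ^ 2 := by
    rw [← Complex.ofReal_pow, Complex.sq_norm, Complex.normSq_apply]
    push_cast; ring
  have : (Real.pi : ℂ) ≠ 0 := by exact_mod_cast Real.pi_ne_zero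
  rw [hn]
  field_simp
  ring_nf
  rw [I_sq]
  ring

/-- The Itô–Hermite polynomials in two independent variables. -/
noncomputable def itoHermite (j r : ℕ) (u v : ℂ) : ℂ :=
  ∑ k ∈ Finset.range (j + 1), ((k ! * j.choose k * r.choose k : ℕ) : ℂ) * u ^ (j - k) * v ^ (r - k)

/-- Terms with k > min(j, r) vanish, so the truncation may be placed at either index; each branch of
`complexHermite` needs the smaller one. -/
theorem itoHermite_eq_sum_range (j r : ℕ) (u v : ℂ) :
    itoHermite j r u v = ∑ k ∈ Finset.range (r + 1),
      ((k ! * j.choose k * r.choose k : ℕ) : ℂ) * u ^ (j - k) * v ^ (r - k) := by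
  have aux : ∀ n m : ℕ, n ≤ m → (∀ k, n ≤ k → k ! * j.choose k * r.choose k = 0) →
      ∑ k ∈ Finset.range n, ((k ! * j.choose k * r.choose k : ℕ) : ℂ) * u ^ (j - k) * v ^ (r - k) =
      ∑ k ∈ Finset.range m, ((k ! * j.choose k * r.choose k : ℕ) : ℂ) * u ^ (j - k) * v ^ (r - k) :=
    fun n m hnm hk => Finset.sum_subset (Finset.range_mono hnm) fun k _ hkn => by
      rw [hk k (by simpa using hkn)]; simp
  rcases le_total j r with h | h
  · exact aux _ _ (by omega) fun k hk => by simp [Nat.choose_eq_zero_of_lt (show j < k by omega)]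
  · exact (aux _ _ (by omega)
      fun k hk => by simp [Nat.choose_eq_zero_of_lt (show r < k by omega)]).symm

theorem itoHermite_zero (r : ℕ) (u v : ℂ) : itoHermite 0 r u v = v ^ r := by
  simp [itoHermite]

/-- Pascal's rule splits the sum, and the shifted half is absorbed through (k+1)! C(r, k+1) = r k!
C(r-1, k). -/
theorem itoHermite_succ (j r : ℕ) (u v : ℂ) :
    itoHermite (j + 1) r u v = u * itoHermite j r u v + r * itoHermite j (r - 1) u v := by
  have h1 : u * itoHermite j r u v = ∑ k ∈ Finset.range (j + 1 + 1),
      ((k ! * j.choose k * r.choose k : ℕ) : ℂ) * u ^ (j + 1 - k) * v ^ (r - k) := by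
    rw [Finset.sum_range_succ, itoHermite, Finset.mul_sum]
    simp only [Nat.choose_succ_self, mul_zero, zero_mul, Nat.cast_zero, add_zero]
    refine Finset.sum_congr rfl fun k hk => ?_
    rw [Nat.sub_add_comm (Nat.lt_succ_iff.mp (Finset.mem_range.mp hk)), pow_succ]
    ring
  rw [h1, itoHermite, itoHermite, Finset.sum_range_succ' _ (j + 1),
    Finset.sum_range_succ' _ (j + 1), Finset.mul_sum]
  simp only [Nat.choose_zero_right]
  rw [add_right_comm, ← Finset.sum_add_distrib]
  congr 1
  refine Finset.sum_congr rfl fun k _ => ?_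
  have h2 : (k + 1)! * r.choose (k + 1) = k ! * (r * (r - 1).choose k) := by
    cases r with
    | zero => simp
    | succ r =>
      rw [Nat.add_sub_cancel, Nat.add_one_mul_choose_eq, Nat.factorial_succ]
      ring
  have h3 : r - 1 - k = r - (k + 1) := by omega
  rw [h3, Nat.choose_succ_succ, Nat.add_sub_add_right]
  have h2' := congrArg (fun n : ℕ => (n : ℂ)) h2
  push_cast at h2' ⊢
  linear_combination (j.choose k * u ^ (j - k) * v ^ (r - (k + 1)) : ℂ) * h2'

theorem laguerre_reflect (k a : ℕ) (x : ℝ) :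
    laguerre k a x = ∑ i ∈ Finset.range (k + 1),
      (-1) ^ (k - i) * ((k + a).choose i : ℝ) * x ^ (k - i) / ((k - i)! : ℝ) := by
  rw [laguerre, ← Finset.sum_range_reflect]
  refine Finset.sum_congr rfl fun i hi => ?_
  have := Finset.mem_range.mp hi
  have h1 : k + 1 - 1 - i = k - i := by omega
  have h2 : k - (k - i) = i := by omega
  rw [h1, h2]

theorem factorial_mul_choose_eq {r k : ℕ} (h : k ≤ r) :
    ((k ! * r.choose k : ℕ) : ℂ) = r ! / (r - k)! := by
  rw [eq_div_iff (by exact_mod_cast (Nat.factorial_ne_zero _)), ← Nat.cast_mul]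
  congr 1
  rw [← Nat.choose_mul_factorial_mul_factorial h]
  ring

/-- With u = √π z and v = -√π z̄ one has uv = -π|z|², and the reversed Laguerre sum matches term by
term. The sign of v supplies the factor (-1)^{r-j}. Both branches thus become one polynomial, whose
recursion needs no case distinction. -/
theorem complexHermite_eq_itoHermite (j r : ℕ) (z : ℂ) :
    (√(j ! : ℝ) * √(r ! : ℝ) : ℂ) * complexHermite j r z =
      itoHermite j r (√Real.pi * z) (-(√Real.pi * conj z)) := by
  have huv : ((Real.pi * ‖z‖ ^ 2 : ℝ) : ℂ) = (√Real.pi * z) * (√Real.pi * conj z) := by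
    have hp : (√Real.pi : ℂ) * √Real.pi = Real.pi := by
      exact_mod_cast Real.mul_self_sqrt Real.pi_pos.le
    have hn : z * conj z = ((‖z‖ ^ 2 : ℝ) : ℂ) := by
      rw [Complex.mul_conj, Complex.normSq_eq_norm_sq]
    push_cast at hn ⊢
    rw [← hn, ← hp]
    ring
  have hj : (√(j ! : ℝ) : ℂ) ≠ 0 := by
    exact_mod_cast (Real.sqrt_pos.mpr (Nat.cast_pos.mpr (Nat.factorial_pos j))).ne'
  have hr : (√(r ! : ℝ) : ℂ) ≠ 0 := by
    exact_mod_cast (Real.sqrt_pos.mpr (Nat.cast_pos.mpr (Nat.factorial_pos r))).ne'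
  have hj2 : (√(j ! : ℝ) : ℂ) * √(j ! : ℝ) = j ! := by
    exact_mod_cast Real.mul_self_sqrt (Nat.cast_nonneg _)
  have hr2 : (√(r ! : ℝ) : ℂ) * √(r ! : ℝ) = r ! := by
    exact_mod_cast Real.mul_self_sqrt (Nat.cast_nonneg _)
  rw [complexHermite]
  split_ifs with h
  · rw [itoHermite_eq_sum_range, laguerre_reflect, Real.sqrt_div (Nat.cast_nonneg _),
      Complex.ofReal_sum, Finset.mul_sum, Finset.mul_sum]
    refine Finset.sum_congr rfl fun k hk => ?_
    have hk' : k ≤ r := Nat.lt_succ_iff.mp (Finset.mem_range.mp hk)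
    have h1 : ((k ! * j.choose k * r.choose k : ℕ) : ℂ) = r ! / (r - k)! * j.choose k := by
      rw [← factorial_mul_choose_eq hk']; push_cast; ring
    have h2 : j - k = (j - r) + (r - k) := by omega
    have h3 : r + (j - r) = j := by omega
    rw [h1, h2, h3, pow_add, neg_pow (√Real.pi * conj z : ℂ)]
    push_cast at huv ⊢
    rw [huv, mul_pow, mul_pow (_ : ℂ) z (j - r), ← hr2]
    field_simp
  · rw [itoHermite, laguerre_reflect, Real.sqrt_div (Nat.cast_nonneg _),
      Complex.ofReal_sum, Finset.mul_sum, Finset.mul_sum]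
    refine Finset.sum_congr rfl fun k hk => ?_
    have hk' : k ≤ j := Nat.lt_succ_iff.mp (Finset.mem_range.mp hk)
    have h1 : ((k ! * j.choose k * r.choose k : ℕ) : ℂ) = j ! / (j - k)! * r.choose k := by
      rw [← factorial_mul_choose_eq hk']; push_cast; ring
    have h2 : r - k = (r - j) + (j - k) := by omega
    have h3 : j + (r - j) = r := by omega
    rw [h1, h2, h3, pow_add, neg_pow (√Real.pi * conj z : ℂ), neg_pow (√Real.pi * conj z : ℂ)]
    push_cast at huv ⊢
    rw [huv, mul_pow, mul_pow (_ : ℂ) (conj z) (r - j), ← hj2]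
    field_simp

theorem complexHermite_zero (r : ℕ) (z : ℂ) :
    (√(r ! : ℝ) : ℂ) * complexHermite 0 r z = (-(√Real.pi * conj z)) ^ r := by
  have := complexHermite_eq_itoHermite 0 r z
  rw [itoHermite_zero] at this
  simpa using this

theorem ofReal_sqrt_factorial_ne_zero (n : ℕ) : (√(n ! : ℝ) : ℂ) ≠ 0 := by
  exact_mod_cast (Real.sqrt_pos.mpr (Nat.cast_pos.mpr (Nat.factorial_pos n))).ne'

theorem ofReal_sqrt_succ_ne_zero (n : ℕ) : (√(n + 1 : ℝ) : ℂ) ≠ 0 := by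
  exact_mod_cast (Real.sqrt_pos.mpr (by positivity)).ne'

theorem complexHermite_succ (j r : ℕ) (z : ℂ) :
    √(j + 1) * complexHermite (j + 1) r z =
      √r * complexHermite j (r - 1) z + √Real.pi * z * complexHermite j r z := by
  have h0 := complexHermite_eq_itoHermite (j + 1) r z
  have h1 := complexHermite_eq_itoHermite j r z
  have h2 := complexHermite_eq_itoHermite j (r - 1) z
  rw [itoHermite_succ, ← h1, ← h2, sqrt_factorial_succ] at h0
  refine mul_left_cancel₀ (mul_ne_zero (ofReal_sqrt_factorial_ne_zero j)
    (ofReal_sqrt_factorial_ne_zero r)) ?_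
  have hr : (r : ℂ) * √((r - 1)! : ℝ) = √r * √(r ! : ℝ) := by
    cases r with
    | zero => simp
    | succ r =>
      rw [sqrt_factorial_succ, Nat.add_sub_cancel]
      push_cast
      have : (√(r + 1 : ℝ) : ℂ) * √(r + 1 : ℝ) = r + 1 := by
        exact_mod_cast Real.mul_self_sqrt (by positivity)
      rw [← this]
      ring
  push_cast at h0
  linear_combination h0 + √(j ! : ℝ) * complexHermite j (r - 1) z * hr

/-- Both sides satisfy the same recursion in j. On the edge j = 0 the recursion in r loses its lower
term and reduces to multiplication by -√π z̄, starting from the Gaussian. -/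
theorem hermiteWigner_eq (j r : ℕ) (z : ℂ) :
    hermiteWigner j r z = complexHermite j r z * (Real.exp (-(Real.pi / 2) * ‖z‖ ^ 2) : ℂ) := by
  induction j generalizing r with
  | zero =>
    induction r with
    | zero =>
      have := complexHermite_zero 0 z
      simp only [Nat.factorial_zero, Nat.cast_one, Real.sqrt_one, pow_zero, ofReal_one,
        one_mul] at this
      rw [this, one_mul, hermiteWigner_zero_zero]
    | succ r ih =>
      refine mul_left_cancel₀ (ofReal_sqrt_succ_ne_zero r) ?_
      refine mul_left_cancel₀ (ofReal_sqrt_factorial_ne_zero r) ?_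
      have h1 := complexHermite_zero (r + 1) z
      have h2 := complexHermite_zero r z
      rw [pow_succ, ← h2, sqrt_factorial_succ] at h1
      rw [hermiteWigner_succ_right, ih]
      push_cast at h1 ⊢
      simp only [Real.sqrt_zero, ofReal_zero, zero_mul]
      linear_combination -cexp (-(Real.pi / 2) * ‖z‖ ^ 2) * h1
  | succ j ih =>
    refine mul_left_cancel₀ (ofReal_sqrt_succ_ne_zero j) ?_
    rw [hermiteWigner_succ_left, ih, ih]
    linear_combination -(Real.exp (-(Real.pi / 2) * ‖z‖ ^ 2) : ℂ) * complexHermite_succ j r z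

end ComplexHermiteBasis

/-! ### Addition formula and concentration in the index j -/

section ComplexHermiteAddition

theorem norm_sq_hermiteWigner_eq (j r : ℕ) (z : ℂ) :
    hermiteWigner j r z * conj (hermiteWigner j r z) = ((‖hermiteWigner j r z‖ ^ 2 : ℝ) : ℂ) := by
  rw [Complex.mul_conj, Complex.normSq_eq_norm_sq]

theorem hermiteWigner_zero_right (j : ℕ) (z : ℂ) :
    √(j ! : ℝ) * hermiteWigner j 0 z =
      (√Real.pi * z) ^ j * (Real.exp (-(Real.pi / 2) * ‖z‖ ^ 2) : ℂ) := by
  induction j with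
  | zero => simp [hermiteWigner_zero_zero]
  | succ j ih =>
    have h := hermiteWigner_succ_left j 0 z
    simp only [Nat.cast_zero, Real.sqrt_zero, ofReal_zero, zero_mul, zero_add] at h
    rw [sqrt_factorial_succ]
    push_cast at ih ⊢
    linear_combination √(j ! : ℝ) * h + √Real.pi * z * ih

theorem hasSum_of_hasSum_succ {f : ℕ → ℂ} {a : ℂ} (h0 : f 0 = 0)
    (h : HasSum (fun j => f (j + 1)) a) : HasSum f a := by
  have := (hasSum_nat_add_iff (f := f) 1).mp h
  simpa [h0] using this

/-- The renormalized matrix coefficient of two displaced Hermite functions. -/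
noncomputable def shiftedWigner (r s : ℕ) (z w : ℂ) : ℂ :=
  cexp (Real.pi / 2 * (z * conj w - conj z * w)) * hermiteWigner s r (z - w)

theorem hasSum_hermiteWigner_zero_zero (z w : ℂ) :
    HasSum (fun j => hermiteWigner j 0 z * conj (hermiteWigner j 0 w)) (shiftedWigner 0 0 z w) := by
  have hp : (√Real.pi : ℂ) * √Real.pi = Real.pi := by
    exact_mod_cast Real.mul_self_sqrt Real.pi_pos.le
  have h := (NormedSpace.expSeries_div_hasSum_exp (Real.pi * (z * conj w) : ℂ)).mul_right
    ((Real.exp (-(Real.pi / 2) * ‖z‖ ^ 2) : ℂ) * (Real.exp (-(Real.pi / 2) * ‖w‖ ^ 2) : ℂ))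
  convert! h using 1
  · ext j
    have hz := hermiteWigner_zero_right j z
    have hw := congrArg conj (hermiteWigner_zero_right j w)
    simp only [map_mul, map_pow, Complex.conj_ofReal] at hw
    have hj : (√(j ! : ℝ) : ℂ) * √(j ! : ℝ) = j ! := by
      exact_mod_cast Real.mul_self_sqrt (Nat.cast_nonneg _)
    have hj0 : (j ! : ℂ) ≠ 0 := by exact_mod_cast Nat.factorial_ne_zero j
    refine mul_left_cancel₀ hj0 ?_
    have : (j ! : ℂ) * ((Real.pi * (z * conj w)) ^ j / j ! *
        ((Real.exp (-(Real.pi / 2) * ‖z‖ ^ 2) : ℂ) * (Real.exp (-(Real.pi / 2) * ‖w‖ ^ 2) : ℂ))) =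
        (√Real.pi * z) ^ j * (Real.exp (-(Real.pi / 2) * ‖z‖ ^ 2) : ℂ) *
        ((√Real.pi * conj w) ^ j * (Real.exp (-(Real.pi / 2) * ‖w‖ ^ 2) : ℂ)) := by
      rw [← hp, show (√Real.pi * √Real.pi * (z * conj w) : ℂ) =
        (√Real.pi * z) * (√Real.pi * conj w) by ring, mul_pow]
      field_simp
    rw [this, ← hz, ← hw, ← hj]
    ring
  · rw [shiftedWigner, hermiteWigner_zero_zero, ← Complex.exp_eq_exp_ℂ]
    simp only [Complex.ofReal_exp, ← Complex.exp_add]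
    congr 1
    have hn : ∀ u : ℂ, (‖u‖ : ℂ) ^ 2 = u * conj u := fun u => by
      rw [Complex.mul_conj, Complex.normSq_eq_norm_sq]; push_cast; rfl
    push_cast
    simp only [hn, map_sub]
    ring

/-- The addition formula for complex Hermite functions. -/
theorem hasSum_hermiteWigner (r s : ℕ) (z w : ℂ) :
    HasSum (fun j => hermiteWigner j r z * conj (hermiteWigner j s w)) (shiftedWigner r s z w) := by
  have hconj : ∀ (j s : ℕ), √(s + 1) * conj (hermiteWigner j (s + 1) w) =
      √j * conj (hermiteWigner (j - 1) s w) - √Real.pi * w * conj (hermiteWigner j s w) := by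
    intro j s
    have := congrArg conj (hermiteWigner_succ_right j s w)
    simpa only [map_mul, map_sub, Complex.conj_ofReal, Complex.conj_conj] using this
  induction r generalizing s with
  | zero =>
    induction s with
    | zero => exact hasSum_hermiteWigner_zero_zero z w
    | succ s ih =>
      -- The factor √j kills the term j = 0; after the shift, the ladder relation in j replaces
      -- √(j+1) W_{j+1,0} by √π z W_{j,0}.
      have h1 : HasSum (fun j : ℕ => √j * hermiteWigner j 0 z * conj (hermiteWigner (j - 1) s w))
          (√Real.pi * z * shiftedWigner 0 s z w) := by
        refine hasSum_of_hasSum_succ (by simp) ?_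
        convert! ih.mul_left (√Real.pi * z) using 1
        ext j
        have h := hermiteWigner_succ_left j 0 z
        simp only [Nat.cast_zero, Real.sqrt_zero, ofReal_zero, zero_mul, zero_add] at h
        push_cast
        rw [h]
        ring
      have h2 := (h1.sub (ih.mul_left (√Real.pi * w))).mul_left ((√(s + 1 : ℝ) : ℂ)⁻¹)
      convert! h2 using 1
      · ext j
        rw [eq_inv_mul_iff_mul_eq₀ (ofReal_sqrt_succ_ne_zero s)]
        linear_combination hermiteWigner j 0 z * hconj j s
      · rw [eq_inv_mul_iff_mul_eq₀ (ofReal_sqrt_succ_ne_zero s), shiftedWigner, shiftedWigner]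
        have h := hermiteWigner_succ_left s 0 (z - w)
        simp only [Nat.cast_zero, Real.sqrt_zero, ofReal_zero, zero_mul, zero_add] at h
        linear_combination cexp (Real.pi / 2 * (z * conj w - conj z * w)) * h
  | succ r ih =>
    have h1 : HasSum (fun j : ℕ => √j * hermiteWigner (j - 1) r z * conj (hermiteWigner j s w))
        (√s * shiftedWigner r (s - 1) z w + √Real.pi * conj w * shiftedWigner r s z w) := by
      refine hasSum_of_hasSum_succ (by simp) ?_
      convert! ((ih (s - 1)).mul_left (√s : ℂ)).add ((ih s).mul_left (√Real.pi * conj w)) using 1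
      ext j
      have h := congrArg conj (hermiteWigner_succ_left j s w)
      simp only [map_mul, map_add, Complex.conj_ofReal] at h
      push_cast
      linear_combination hermiteWigner j r z * h
    have h2 := (h1.sub ((ih s).mul_left (√Real.pi * conj z))).mul_left ((√(r + 1 : ℝ) : ℂ)⁻¹)
    convert! h2 using 1
    · ext j
      rw [eq_inv_mul_iff_mul_eq₀ (ofReal_sqrt_succ_ne_zero r)]
      linear_combination conj (hermiteWigner j s w) * hermiteWigner_succ_right j r z
    · rw [eq_inv_mul_iff_mul_eq₀ (ofReal_sqrt_succ_ne_zero r), shiftedWigner, shiftedWigner,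
        shiftedWigner]
      have h := hermiteWigner_succ_right s r (z - w)
      simp only [map_sub] at h
      linear_combination cexp (Real.pi / 2 * (z * conj w - conj z * w)) * h

theorem hermiteWigner_self_zero (r : ℕ) : hermiteWigner r r 0 = 1 := by
  rw [hermiteWigner_eq, complexHermite, if_neg (lt_irrefl r)]
  simp only [Nat.sub_self, pow_zero, norm_zero]
  rw [laguerre, Finset.sum_range_succ']
  simp [Nat.factorial_ne_zero]

/-- The addition formula on the diagonal z = w, where W_{r,r}(0) = 1. It holds at every level r,
which makes the neighbouring levels in the three-term relation equally controllable. -/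
theorem hasSum_norm_sq_hermiteWigner (r : ℕ) (z : ℂ) :
    HasSum (fun j => ‖hermiteWigner j r z‖ ^ 2) 1 := by
  have h := hasSum_hermiteWigner r r z z
  simp only [norm_sq_hermiteWigner_eq, shiftedWigner, sub_self, hermiteWigner_self_zero, mul_one,
    mul_comm z (conj z), mul_zero, Complex.exp_zero] at h
  rw [← Complex.ofReal_one] at h
  exact Complex.hasSum_ofReal.mp h

theorem sum_norm_sq_hermiteWigner_le (r : ℕ) (z : ℂ) (t : Finset ℕ) :
    ∑ j ∈ t, ‖hermiteWigner j r z‖ ^ 2 ≤ 1 :=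
  sum_le_hasSum t (fun _ _ => sq_nonneg _) (hasSum_norm_sq_hermiteWigner r z)

theorem norm_hermiteWigner_le_one (j r : ℕ) (z : ℂ) : ‖hermiteWigner j r z‖ ≤ 1 := by
  have := sum_norm_sq_hermiteWigner_le r z {j}
  rw [Finset.sum_singleton] at this
  exact (sq_le_one_iff₀ (norm_nonneg _)).mp this

/-- The ladder relations express j W_{j,r} and r W_{j,r} through neighbours; in the combination the
terms with index j - 1 cancel, so that only the level r changes. -/
theorem hermiteWigner_three_term (j r : ℕ) (z : ℂ) :
    ((j : ℂ) - Real.pi * ‖z‖ ^ 2) * hermiteWigner j r z =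
      r * hermiteWigner j r z + √r * (√Real.pi * conj z) * hermiteWigner j (r - 1) z +
        √(r + 1) * (√Real.pi * z) * hermiteWigner j (r + 1) z := by
  have hsq : ∀ n : ℕ, (√(n : ℝ) : ℂ) * √(n : ℝ) = n := fun n => by
    exact_mod_cast Real.mul_self_sqrt (Nat.cast_nonneg n)
  have hp : (√Real.pi : ℂ) * √Real.pi = Real.pi := by
    exact_mod_cast Real.mul_self_sqrt Real.pi_pos.le
  have hn : (‖z‖ : ℂ) ^ 2 = z * conj z := by
    rw [Complex.mul_conj, Complex.normSq_eq_norm_sq]; push_cast; rfl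
  have h1 : √j * hermiteWigner j r z * √j =
      (√r * hermiteWigner (j - 1) (r - 1) z + √Real.pi * z * hermiteWigner (j - 1) r z) * √j := by
    cases j with
    | zero => simp
    | succ j =>
      have := hermiteWigner_succ_left j r z
      push_cast
      rw [this]
  have h2 : √r * (√r * hermiteWigner j r z) =
      √r * (√j * hermiteWigner (j - 1) (r - 1) z -
        √Real.pi * conj z * hermiteWigner j (r - 1) z) := by
    cases r with
    | zero => simp
    | succ r =>
      have := hermiteWigner_succ_right j r z
      push_cast
      rw [this]
  have h3 := hermiteWigner_succ_right j r z
  rw [hn, ← hp, ← hsq j, ← hsq r]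
  linear_combination h1 - h2 - √Real.pi * z * h3

/-- Square the three-term relation by (a + b + c)² ≤ 3(a² + b² + c²) and use that each level has
total mass at most 1. -/
theorem sum_sq_mul_norm_sq_hermiteWigner_le (r : ℕ) (z : ℂ) (t : Finset ℕ) :
    ∑ j ∈ t, ((j : ℝ) - Real.pi * ‖z‖ ^ 2) ^ 2 * ‖hermiteWigner j r z‖ ^ 2 ≤
      3 * (r ^ 2 + (2 * r + 1) * (Real.pi * ‖z‖ ^ 2)) := by
  have hp : √Real.pi ^ 2 = Real.pi := Real.sq_sqrt Real.pi_pos.le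
  have hterm : ∀ j : ℕ, ((j : ℝ) - Real.pi * ‖z‖ ^ 2) ^ 2 * ‖hermiteWigner j r z‖ ^ 2 ≤
      3 * (r ^ 2 * ‖hermiteWigner j r z‖ ^ 2 +
        r * (Real.pi * ‖z‖ ^ 2) * ‖hermiteWigner j (r - 1) z‖ ^ 2 +
        (r + 1) * (Real.pi * ‖z‖ ^ 2) * ‖hermiteWigner j (r + 1) z‖ ^ 2) := fun j => by
    have h := congrArg (fun w => ‖w‖) (hermiteWigner_three_term j r z)
    have h1 : ((j : ℂ) - Real.pi * ‖z‖ ^ 2) = (((j : ℝ) - Real.pi * ‖z‖ ^ 2 : ℝ) : ℂ) := by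
      push_cast; rfl
    simp only [h1, norm_mul, Complex.norm_real, Real.norm_eq_abs] at h
    have h2 := norm_add₃_le (a := r * hermiteWigner j r z)
      (b := √r * (√Real.pi * conj z) * hermiteWigner j (r - 1) z)
      (c := √(r + 1) * (√Real.pi * z) * hermiteWigner j (r + 1) z)
    rw [← h] at h2
    simp only [norm_mul, Complex.norm_real, Real.norm_eq_abs, Complex.norm_natCast,
      Complex.norm_conj, abs_of_nonneg (Real.sqrt_nonneg _)] at h2
    set a := r * ‖hermiteWigner j r z‖
    set b := √r * (√Real.pi * ‖z‖) * ‖hermiteWigner j (r - 1) z‖ with hb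
    set c := √(r + 1) * (√Real.pi * ‖z‖) * ‖hermiteWigner j (r + 1) z‖ with hc
    have hb2 : b ^ 2 = r * (Real.pi * ‖z‖ ^ 2) * ‖hermiteWigner j (r - 1) z‖ ^ 2 := by
      rw [hb, mul_pow, mul_pow, mul_pow, hp, Real.sq_sqrt (by positivity)]
    have hc2 : c ^ 2 = (r + 1) * (Real.pi * ‖z‖ ^ 2) * ‖hermiteWigner j (r + 1) z‖ ^ 2 := by
      rw [hc, mul_pow, mul_pow, mul_pow, hp, Real.sq_sqrt (by positivity)]
    rw [← hb2, ← hc2, ← mul_pow, ← sq_abs, abs_mul, abs_of_nonneg (norm_nonneg _), ← mul_pow]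
    have h3 : (|(j : ℝ) - Real.pi * ‖z‖ ^ 2| * ‖hermiteWigner j r z‖) ^ 2 ≤ (a + b + c) ^ 2 := by
      gcongr
    nlinarith [sq_nonneg (a - b), sq_nonneg (b - c), sq_nonneg (a - c)]
  refine (Finset.sum_le_sum fun j _ => hterm j).trans ?_
  rw [← Finset.mul_sum, Finset.sum_add_distrib, Finset.sum_add_distrib, ← Finset.mul_sum,
    ← Finset.mul_sum, ← Finset.mul_sum]
  have h1 := sum_norm_sq_hermiteWigner_le r z t
  have h2 := sum_norm_sq_hermiteWigner_le (r - 1) z t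
  have h3 := sum_norm_sq_hermiteWigner_le (r + 1) z t
  have hs : 0 ≤ Real.pi * ‖z‖ ^ 2 := by positivity
  have e1 := mul_le_mul_of_nonneg_left h1 (sq_nonneg (r : ℝ))
  have e2 := mul_le_mul_of_nonneg_left h2 (mul_nonneg (Nat.cast_nonneg (α := ℝ) r) hs)
  have e3 := mul_le_mul_of_nonneg_left h3
    (mul_nonneg (add_nonneg (Nat.cast_nonneg (α := ℝ) r) zero_le_one) hs)
  linarith

/-- Let S be the tail, d = N - π|z|² ≥ 0 and K = 3(r+1)²N. Then S ≤ 1, and Chebyshev gives d² S ≤ K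
because every j in the tail is at distance at least d from π|z|². Adding, S (1 + d²/K) ≤ 2. This
smooth form is chosen because its radial integral is an arctangent. -/
theorem sum_tail_norm_sq_hermiteWigner_le (r N : ℕ) (hN : 1 ≤ N) (z : ℂ)
    (hz : Real.pi * ‖z‖ ^ 2 ≤ N) (t : Finset ℕ) (ht : ∀ j ∈ t, N ≤ j) :
    ∑ j ∈ t, ‖hermiteWigner j r z‖ ^ 2 ≤
      2 / (1 + ((Real.pi * ‖z‖ ^ 2 - N) / √(3 * (r + 1) ^ 2 * N)) ^ 2) := by
  have hN' : (1 : ℝ) ≤ N := by exact_mod_cast hN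
  have hK : (0 : ℝ) < 3 * (r + 1) ^ 2 * N := by positivity
  rw [div_pow, Real.sq_sqrt hK.le]
  set K : ℝ := 3 * (r + 1) ^ 2 * N with hKdef
  rw [le_div_iff₀ (by positivity)]
  have h1 := sum_norm_sq_hermiteWigner_le r z t
  have h2 := sum_sq_mul_norm_sq_hermiteWigner_le r z t
  have h3 : (Real.pi * ‖z‖ ^ 2 - N) ^ 2 * ∑ j ∈ t, ‖hermiteWigner j r z‖ ^ 2 ≤
      ∑ j ∈ t, ((j : ℝ) - Real.pi * ‖z‖ ^ 2) ^ 2 * ‖hermiteWigner j r z‖ ^ 2 := by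
    rw [Finset.mul_sum]
    refine Finset.sum_le_sum fun j hj => mul_le_mul_of_nonneg_right ?_ (sq_nonneg _)
    have : (N : ℝ) ≤ j := by exact_mod_cast ht j hj
    nlinarith
  have h4 : 3 * (r ^ 2 + (2 * r + 1) * (Real.pi * ‖z‖ ^ 2)) ≤ K := by
    have hr : (0 : ℝ) ≤ r := Nat.cast_nonneg r
    have e1 : (2 * r + 1) * (Real.pi * ‖z‖ ^ 2) ≤ (2 * r + 1) * (N : ℝ) := by gcongr
    have e2 : (r : ℝ) ^ 2 * 1 ≤ r ^ 2 * N := by gcongr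
    rw [hKdef]
    nlinarith
  have h5 : (Real.pi * ‖z‖ ^ 2 - N) ^ 2 * ∑ j ∈ t, ‖hermiteWigner j r z‖ ^ 2 / K ≤ 1 := by
    rw [← Finset.sum_div, ← mul_div_assoc, div_le_one hK]
    exact (h3.trans h2).trans h4
  rw [← Finset.sum_div] at h5
  have : (∑ j ∈ t, ‖hermiteWigner j r z‖ ^ 2) * (1 + (Real.pi * ‖z‖ ^ 2 - N) ^ 2 / K) =
    ∑ j ∈ t, ‖hermiteWigner j r z‖ ^ 2 +
    (Real.pi * ‖z‖ ^ 2 - N) ^ 2 * ((∑ j ∈ t, ‖hermiteWigner j r z‖ ^ 2) / K) := by ring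
  rw [this]
  linarith

end ComplexHermiteAddition

/-! ### Renormalization, rotations and integrability on phase space -/

section PhaseSpaceFunctions

theorem inner_toLp_left {f : ℂ → ℂ} (hf : MemLp f 2 (volume : Measure ℂ))
    (F : Lp ℂ 2 (volume : Measure ℂ)) :
    inner ℂ (hf.toLp f) F = ∫ z, conj (f z) * F z := by
  rw [L2.inner_def]
  refine integral_congr_ae ?_
  filter_upwards [hf.coeFn_toLp] with z hz
  rw [hz, RCLike.inner_apply, mul_comm]

theorem inner_toLp_toLp {f g : ℂ → ℂ} (hf : MemLp f 2 (volume : Measure ℂ))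
    (hg : MemLp g 2 (volume : Measure ℂ)) :
    inner ℂ (hf.toLp f) (hg.toLp g) = ∫ z, conj (f z) * g z := by
  rw [inner_toLp_left]
  refine integral_congr_ae ?_
  filter_upwards [hg.coeFn_toLp] with z hz
  rw [hz]

theorem integrable_conj_mul {f g : ℂ → ℂ} {μ : Measure ℂ} (hf : MemLp f 2 μ) (hg : MemLp g 2 μ) :
    Integrable (fun z => conj (f z) * g z) μ := by
  have : MemLp (fun z => conj (f z)) 2 μ := hf.star
  exact this.integrable_mul hg

theorem renormFun_renormFun (f : ℂ → ℂ) : renormFun (renormFun f) = f := by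
  ext z
  simp only [renormFun, Complex.conj_re, Complex.conj_im, Complex.conj_conj]
  rw [← mul_assoc, ← Complex.exp_add]
  push_cast
  rw [show (-(Real.pi * I * (z.re * z.im)) + -(Real.pi * I * (z.re * -z.im)) : ℂ) = 0 by ring]
  simp

theorem norm_cexp_renorm (z : ℂ) : ‖cexp (-(Real.pi * I * (z.re * z.im)))‖ = 1 := by
  have : (-(Real.pi * I * (z.re * z.im)) : ℂ) = ((-(Real.pi * (z.re * z.im)) : ℝ) : ℂ) * I := by
    push_cast; ring
  rw [this, Complex.norm_exp_ofReal_mul_I]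

theorem norm_renormFun (f : ℂ → ℂ) (z : ℂ) : ‖renormFun f z‖ = ‖f (conj z)‖ := by
  rw [renormFun, norm_mul, norm_cexp_renorm, one_mul]

theorem measurePreserving_conj : MeasurePreserving (fun z : ℂ => conj z) volume volume :=
  Complex.conjLIE.measurePreserving

theorem measurableEmbedding_conj : MeasurableEmbedding (fun z : ℂ => conj z) :=
  Complex.conjLIE.toHomeomorph.measurableEmbedding

theorem memLp_renormFun {f : ℂ → ℂ} (hf : MemLp f 2 (volume : Measure ℂ)) :
    MemLp (renormFun f) 2 (volume : Measure ℂ) := by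
  have h := hf.comp_measurePreserving measurePreserving_conj
  have hc : Continuous fun z : ℂ => cexp (-(Real.pi * I * (z.re * z.im))) := by fun_prop
  exact (memLp_congr_norm (hc.aestronglyMeasurable.mul h.1) h.1
    (Filter.Eventually.of_forall fun z => norm_renormFun f z)).mpr h

/-- Under z ↦ z̄ the product xξ changes sign, which offsets the conjugation of the phase.
Renormalization is therefore symmetric and, being an involution, unitary. -/
theorem integral_conj_renormFun_mul (f g : ℂ → ℂ) :
    ∫ z, conj (renormFun f z) * g z = ∫ z, conj (f z) * renormFun g z := by
  rw [← measurePreserving_conj.integral_comp measurableEmbedding_conj]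
  congr 1
  ext z
  simp only [renormFun, map_mul, Complex.conj_re, Complex.conj_im, Complex.conj_conj,
    ← Complex.exp_conj, map_neg, Complex.conj_ofReal, Complex.conj_I]
  push_cast
  rw [show (-(Real.pi * -I * (z.re * -z.im)) : ℂ) = -(Real.pi * I * (z.re * z.im)) by ring]
  ring

theorem inner_toLp_renormFun {f : ℂ → ℂ} (hf : MemLp f 2 (volume : Measure ℂ))
    (F : Lp ℂ 2 (volume : Measure ℂ)) :
    inner ℂ ((memLp_renormFun hf).toLp _) F =
      inner ℂ (hf.toLp f) ((memLp_renormFun (Lp.memLp F)).toLp _) := by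
  rw [inner_toLp_left, inner_toLp_toLp, integral_conj_renormFun_mul]

theorem orthonormal_renormFun {p : ℕ → ℂ → ℂ} (hp : ∀ j, MemLp (p j) 2 (volume : Measure ℂ))
    (h : Orthonormal ℂ fun j => (hp j).toLp (p j)) :
    Orthonormal ℂ fun j => (memLp_renormFun (hp j)).toLp (renormFun (p j)) := by
  rw [orthonormal_iff_ite] at h ⊢
  intro i j
  rw [← h i j, inner_toLp_toLp, inner_toLp_toLp, integral_conj_renormFun_mul, renormFun_renormFun]

/-- A function that changes sign under some rotation has vanishing integral over every set that is
invariant under this rotation. -/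
theorem setIntegral_eq_zero_of_rotation {s : Set ℂ} (c : Circle) (hs : ∀ z : ℂ, c * z ∈ s ↔ z ∈ s)
    {G : ℂ → ℂ} (hG : ∀ z, G (c * z) = -G z) : ∫ z in s, G z = 0 := by
  have hmp : MeasurePreserving (rotation c) (volume : Measure ℂ) volume :=
    (rotation c).measurePreserving
  have h := hmp.setIntegral_preimage_emb (rotation c).toHomeomorph.measurableEmbedding G s
  have hpre : (rotation c) ⁻¹' s = s := by
    ext z; rw [Set.mem_preimage, rotation_apply]; exact hs z
  rw [hpre] at h
  simp only [rotation_apply, hG, integral_neg] at h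
  exact self_eq_neg.mp h.symm

theorem exists_circle_conj_pow_mul_pow {k j : ℕ} (h : k ≠ j) :
    ∃ c : Circle, conj (c : ℂ) ^ k * (c : ℂ) ^ j = -1 := by
  have hne : (j : ℝ) - k ≠ 0 := sub_ne_zero.mpr (by exact_mod_cast h.symm)
  -- On the circle c̄^k c^j = c^{j-k}, and this c satisfies c^{j-k} = exp(iπ).
  refine ⟨Circle.exp (Real.pi / (j - k)), ?_⟩
  rw [Circle.coe_exp, ← Complex.exp_conj, ← Complex.exp_nat_mul, ← Complex.exp_nat_mul,
    ← Complex.exp_add, ← Complex.exp_pi_mul_I]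
  congr 1
  have hne' : (j : ℂ) - k ≠ 0 := by exact_mod_cast hne
  simp only [map_mul, Complex.conj_ofReal, Complex.conj_I]
  push_cast
  field_simp
  ring

theorem hermiteWigner_circle_mul (j r : ℕ) (c : Circle) (z : ℂ) :
    hermiteWigner j r (c * z) = (c : ℂ) ^ j * conj (c : ℂ) ^ r * hermiteWigner j r z := by
  have hc : (c : ℂ) * conj (c : ℂ) = 1 := by
    rw [Complex.mul_conj, Circle.normSq_coe, Complex.ofReal_one]
  rw [hermiteWigner_eq, hermiteWigner_eq, norm_mul, Circle.norm_coe, one_mul, complexHermite,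
    complexHermite, norm_mul, Circle.norm_coe, one_mul, map_mul]
  split_ifs with h
  · have : (c : ℂ) ^ j * conj (c : ℂ) ^ r = (c : ℂ) ^ (j - r) := by
      obtain ⟨m, rfl⟩ := Nat.exists_eq_add_of_lt h
      rw [show r + m + 1 - r = m + 1 by omega, add_assoc, pow_add, mul_right_comm, ← mul_pow, hc,
        one_pow, one_mul]
    rw [this, mul_pow]
    ring
  · have : (c : ℂ) ^ j * conj (c : ℂ) ^ r = conj (c : ℂ) ^ (r - j) := by
      obtain ⟨m, rfl⟩ := Nat.exists_eq_add_of_le (not_lt.mp h)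
      rw [Nat.add_sub_cancel_left, pow_add, ← mul_assoc, ← mul_pow, hc, one_pow, one_mul]
    rw [this, mul_pow]
    ring

theorem setIntegral_conj_hermiteWigner_mul {s : Set ℂ} (hs : ∀ (c : Circle) (z : ℂ), c * z ∈ s ↔ z ∈ s)
    {k j : ℕ} (h : k ≠ j) (r : ℕ) :
    ∫ z in s, conj (hermiteWigner k r z) * hermiteWigner j r z = 0 := by
  obtain ⟨c, hc⟩ := exists_circle_conj_pow_mul_pow h
  refine setIntegral_eq_zero_of_rotation c (hs c) fun z => ?_
  have h1 : (c : ℂ) * conj (c : ℂ) = 1 := by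
    rw [Complex.mul_conj, Circle.normSq_coe, Complex.ofReal_one]
  have h2 : (c : ℂ) ^ r * conj (c : ℂ) ^ r = 1 := by rw [← mul_pow, h1, one_pow]
  simp only [hermiteWigner_circle_mul, map_mul, map_pow, Complex.conj_conj]
  linear_combination (conj (c : ℂ) ^ k * (c : ℂ) ^ j) * conj (hermiteWigner k r z) *
    hermiteWigner j r z * h2 + conj (hermiteWigner k r z) * hermiteWigner j r z * hc

theorem continuous_laguerre (k a : ℕ) : Continuous (laguerre k a) := by
  unfold laguerre
  fun_prop

theorem continuous_hermiteWigner (j r : ℕ) : Continuous (hermiteWigner j r) := by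
  have h : ∀ k a, Continuous fun z : ℂ => (laguerre k a (Real.pi * ‖z‖ ^ 2) : ℂ) := fun k a =>
    Complex.continuous_ofReal.comp ((continuous_laguerre k a).comp (by fun_prop))
  have h1 := h r (j - r)
  have h2 := h j (r - j)
  rw [funext (hermiteWigner_eq j r)]
  refine Continuous.mul ?_ (by fun_prop)
  unfold complexHermite
  split_ifs
  · exact (Continuous.mul continuous_const (by fun_prop)).mul h1
  · exact (Continuous.mul continuous_const (by fun_prop)).mul h2

theorem integral_norm_pow_mul_gaussian (n : ℕ) :
    ∫ z : ℂ, ‖z‖ ^ (2 * n) * Real.exp (-Real.pi * ‖z‖ ^ 2) = n ! / Real.pi ^ n := by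
  have h := Complex.integral_rpow_mul_exp_neg_mul_rpow (p := 2) (q := (2 * n : ℕ)) (b := Real.pi)
    one_le_two (lt_of_lt_of_le (by norm_num) (Nat.cast_nonneg _)) Real.pi_pos
  simp only [Real.rpow_natCast, Real.rpow_two] at h
  rw [h, show (((2 * n : ℕ) : ℝ) + 2) / 2 = n + 1 by push_cast; ring,
    show -(((2 * n : ℕ) : ℝ) + 2) / 2 = -((n + 1 : ℕ) : ℝ) by push_cast; ring,
    Real.Gamma_nat_eq_factorial, Real.rpow_neg Real.pi_pos.le, Real.rpow_natCast]
  have := Real.pi_ne_zero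
  field_simp
  ring

theorem integrable_norm_pow_mul_gaussian (n : ℕ) :
    Integrable fun z : ℂ => ‖z‖ ^ (2 * n) * Real.exp (-Real.pi * ‖z‖ ^ 2) := by
  refine Integrable.of_integral_ne_zero ?_
  rw [integral_norm_pow_mul_gaussian]
  have := Real.pi_ne_zero
  positivity

/-- The weight |z|^n strengthens the induction: each ladder step multiplies by z or z̄ and so raises
n by one. The base case is a Gaussian moment. -/
theorem memLp_norm_pow_mul_hermiteWigner (j r n : ℕ) :
    MemLp (fun z => (‖z‖ : ℂ) ^ n * hermiteWigner j r z) 2 (volume : Measure ℂ) := by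
  have hc : ∀ j r n, AEStronglyMeasurable
      (fun z : ℂ => (‖z‖ : ℂ) ^ n * hermiteWigner j r z) volume := fun j r n =>
    (((Complex.continuous_ofReal.comp continuous_norm).pow n).mul
      (continuous_hermiteWigner j r)).aestronglyMeasurable
  induction j generalizing r n with
  | zero =>
    induction r generalizing n with
    | zero =>
      rw [memLp_two_iff_integrable_sq_norm (hc 0 0 n)]
      refine (integrable_norm_pow_mul_gaussian n).congr (Filter.Eventually.of_forall fun z => ?_)
      simp only [hermiteWigner_zero_zero, norm_mul, norm_pow, Complex.norm_real, norm_norm,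
        mul_pow, Real.norm_of_nonneg (Real.exp_nonneg _), ← Real.exp_nat_mul]
      rw [← pow_mul, mul_comm 2 n]
      congr 2
      push_cast
      ring
    | succ r ih =>
      refine (ih (n + 1)).of_le_mul (c := √Real.pi / √(r + 1)) (hc _ _ _)
        (Filter.Eventually.of_forall fun z => ?_)
      have h := congrArg (fun w => ‖w‖) (hermiteWigner_succ_right 0 r z)
      simp only [Nat.cast_zero, Real.sqrt_zero, ofReal_zero, zero_mul, zero_sub, norm_neg,
        norm_mul, Complex.norm_real, Real.norm_eq_abs, abs_of_nonneg (Real.sqrt_nonneg _),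
        Complex.norm_conj] at h
      simp only [norm_mul, norm_pow, Complex.norm_real, norm_norm]
      rw [div_mul_eq_mul_div, le_div_iff₀ (Real.sqrt_pos.mpr (by positivity)), pow_succ]
      refine le_of_eq ?_
      linear_combination ‖z‖ ^ n * h
  | succ j ih =>
    have h1 := (ih (r - 1) n).const_mul ((√(j + 1 : ℝ) : ℂ)⁻¹ * √r)
    have h2 : MemLp (fun z => (‖z‖ : ℂ) ^ n * (z * hermiteWigner j r z)) 2
        (volume : Measure ℂ) := by
      refine (ih r (n + 1)).of_le (((Complex.continuous_ofReal.comp continuous_norm).pow n).mul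
        (continuous_id.mul (continuous_hermiteWigner j r))).aestronglyMeasurable
        (Filter.Eventually.of_forall fun z => ?_)
      simp only [norm_mul, norm_pow, Complex.norm_real, norm_norm, pow_succ]
      rw [mul_assoc]
    refine (h1.add (h2.const_mul ((√(j + 1 : ℝ) : ℂ)⁻¹ * √Real.pi))).ae_eq
      (Filter.Eventually.of_forall fun z => ?_)
    have h := hermiteWigner_succ_left j r z
    rw [← eq_inv_mul_iff_mul_eq₀ (ofReal_sqrt_succ_ne_zero j)] at h
    simp only [Pi.add_apply]
    rw [h]
    ring

theorem memLp_hermiteWigner (j r : ℕ) : MemLp (hermiteWigner j r) 2 (volume : Measure ℂ) := by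
  simpa using memLp_norm_pow_mul_hermiteWigner j r 0

end PhaseSpaceFunctions

/-! ### Orthonormality and expansion of the reproducing kernel -/

section Orthogonality

/-- The `L²` inner product of two complex Hermite functions. -/
noncomputable def wignerPairing (k s j r : ℕ) : ℂ :=
  ∫ z, conj (hermiteWigner k s z) * hermiteWigner j r z

theorem integrable_conj_hermiteWigner_mul (k s j r : ℕ) :
    Integrable fun z => conj (hermiteWigner k s z) * hermiteWigner j r z :=
  integrable_conj_mul (memLp_hermiteWigner k s) (memLp_hermiteWigner j r)

theorem const_mul_integral_eq_of_forall {f g h k : ℂ → ℂ} {a b c d : ℂ} (hg : Integrable g)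
    (hh : Integrable h) (hk : Integrable k)
    (H : ∀ z, a * f z = b * g z + (c * h z - d * k z)) :
    a * (∫ z, f z) = b * (∫ z, g z) + (c * (∫ z, h z) - d * ∫ z, k z) := by
  have := integral_congr_ae (μ := volume) (Filter.Eventually.of_forall H)
  have hs : Integrable fun z => c * h z - d * k z := (hh.const_mul c).sub (hk.const_mul d)
  rw [integral_add (hg.const_mul b) hs,
    integral_sub (hh.const_mul c) (hk.const_mul d)] at this
  simpa only [integral_const_mul] using this

/-- Multiplication by √π z crosses the pairing as √π z̄ on the other factor, where the ladder
relation in s absorbs it. -/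
theorem wignerPairing_succ_left (k s j r : ℕ) :
    √(j + 1) * wignerPairing k s (j + 1) r = √r * wignerPairing k s j (r - 1) +
      (√k * wignerPairing (k - 1) s j r - √(s + 1) * wignerPairing k (s + 1) j r) := by
  have hi := integrable_conj_hermiteWigner_mul
  refine const_mul_integral_eq_of_forall (hi _ _ _ _) (hi _ _ _ _) (hi _ _ _ _) fun z => ?_
  have h1 := hermiteWigner_succ_left j r z
  have h2 := congrArg conj (hermiteWigner_succ_right k s z)
  simp only [map_mul, map_sub, Complex.conj_ofReal, Complex.conj_conj] at h2
  linear_combination conj (hermiteWigner k s z) * h1 + hermiteWigner j r z * h2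

theorem wignerPairing_succ_right (k s j r : ℕ) :
    √(r + 1) * wignerPairing k s j (r + 1) = √j * wignerPairing k s (j - 1) r +
      (√s * wignerPairing k (s - 1) j r - √(k + 1) * wignerPairing (k + 1) s j r) := by
  have hi := integrable_conj_hermiteWigner_mul
  refine const_mul_integral_eq_of_forall (hi _ _ _ _) (hi _ _ _ _) (hi _ _ _ _) fun z => ?_
  have h1 := hermiteWigner_succ_right j r z
  have h2 := congrArg conj (hermiteWigner_succ_left k s z)
  simp only [map_mul, map_add, Complex.conj_ofReal] at h2
  linear_combination conj (hermiteWigner k s z) * h1 + hermiteWigner j r z * h2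

theorem hermiteWigner_self (k : ℕ) (z : ℂ) :
    hermiteWigner k k z =
      ((laguerre k 0 (Real.pi * ‖z‖ ^ 2) * Real.exp (-(Real.pi / 2) * ‖z‖ ^ 2) : ℝ) : ℂ) := by
  rw [hermiteWigner_eq, complexHermite, if_neg (lt_irrefl k)]
  simp [div_self (Nat.cast_ne_zero.mpr (Nat.factorial_ne_zero k) : (k ! : ℝ) ≠ 0)]

/-- The Gaussian moments i!/π^i collapse the Laguerre sum to ∑ (-1)^i C(k, i). -/
theorem wignerPairing_self_zero (k : ℕ) :
    wignerPairing k k 0 0 = if k = 0 then 1 else 0 := by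
  have h1 : ∀ z, conj (hermiteWigner k k z) * hermiteWigner 0 0 z =
      ((∑ i ∈ Finset.range (k + 1), (-1) ^ i * (k.choose (k - i) : ℝ) * Real.pi ^ i / (i ! : ℝ) *
        (‖z‖ ^ (2 * i) * Real.exp (-Real.pi * ‖z‖ ^ 2)) : ℝ) : ℂ) := fun z => by
    rw [hermiteWigner_self, hermiteWigner_zero_zero, Complex.conj_ofReal, ← Complex.ofReal_mul,
      mul_assoc, ← Real.exp_add, laguerre, Finset.sum_mul]
    congr 1
    refine Finset.sum_congr rfl fun i _ => ?_
    rw [mul_pow, ← pow_mul, add_zero, show -(Real.pi / 2) * ‖z‖ ^ 2 + -(Real.pi / 2) * ‖z‖ ^ 2 =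
      -Real.pi * ‖z‖ ^ 2 by ring]
    ring
  rw [wignerPairing]
  simp only [h1]
  rw [integral_complex_ofReal, integral_finsetSum _ fun i _ =>
    (integrable_norm_pow_mul_gaussian i).const_mul _]
  simp only [integral_const_mul, integral_norm_pow_mul_gaussian]
  have h2 : ∀ i ∈ Finset.range (k + 1), (-1 : ℝ) ^ i * (k.choose (k - i) : ℝ) * Real.pi ^ i /
      (i ! : ℝ) * (i ! / Real.pi ^ i) = ((-1) ^ i * (k.choose i : ℤ) : ℤ) := fun i hi => by
    rw [Nat.choose_symm (Nat.lt_succ_iff.mp (Finset.mem_range.mp hi))]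
    have h3 : (i ! : ℝ) ≠ 0 := Nat.cast_ne_zero.mpr (Nat.factorial_ne_zero i)
    have := Real.pi_ne_zero
    push_cast
    field_simp
  rw [Finset.sum_congr rfl h2, ← Int.cast_sum, Int.alternating_sum_range_choose]
  split_ifs <;> simp

theorem wignerPairing_zero (k s : ℕ) :
    wignerPairing k s 0 0 = if k = 0 ∧ s = 0 then 1 else 0 := by
  by_cases h : k = s
  · subst h; simp [wignerPairing_self_zero]
  · rw [if_neg (by omega), wignerPairing]
    obtain ⟨c, hc⟩ := exists_circle_conj_pow_mul_pow h
    have := setIntegral_eq_zero_of_rotation (s := Set.univ) c (by simp)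
      (G := fun z => conj (hermiteWigner k s z) * hermiteWigner 0 0 z) fun z => by
        simp only [hermiteWigner_circle_mul, map_mul, map_pow, Complex.conj_conj]
        linear_combination conj (hermiteWigner k s z) * hermiteWigner 0 0 z * hc
    simpa using this

/-- Complex Hermite functions are orthonormal. -/
theorem wignerPairing_eq (k s j r : ℕ) :
    wignerPairing k s j r = if k = j ∧ s = r then 1 else 0 := by
  induction j generalizing k s r with
  | zero =>
    induction r generalizing k s with
    | zero => exact wignerPairing_zero k s
    | succ r ih =>
      refine mul_left_cancel₀ (ofReal_sqrt_succ_ne_zero r) ?_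
      rw [wignerPairing_succ_right, ih k (s - 1), ih (k + 1) s]
      rcases s with _ | s
      · simp
      · by_cases hk : k = 0 <;> by_cases hs : s = r <;> simp [hk, hs]
  | succ j ih =>
    refine mul_left_cancel₀ (ofReal_sqrt_succ_ne_zero j) ?_
    rw [wignerPairing_succ_left, ih, ih (k - 1) s, ih k (s + 1)]
    -- The terms that change the level cancel: both live on k = j, s + 1 = r with equal
    -- coefficients. The case r = 0 survives truncation because √0 = 0.
    have h1 : (√r : ℂ) * (if k = j ∧ s = r - 1 then 1 else 0) =
        √(s + 1) * (if k = j ∧ s + 1 = r then 1 else 0) := by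
      rcases r with _ | r
      · simp
      · by_cases hs : s = r <;> simp [hs]
    rw [h1, add_sub_cancel]
    rcases k with _ | k
    · simp
    · by_cases hk : k = j <;> simp [hk]

/-- The short-time Fourier transforms of the Hermite functions with Hermite window. -/
noncomputable def hermiteSTFT (j r : ℕ) : ℂ → ℂ := stft (hermiteFun r) (hermiteFun j)

theorem hermiteSTFT_eq (j r : ℕ) : hermiteSTFT j r = renormFun (hermiteWigner j r) :=
  (renormFun_renormFun _).symm

theorem hermiteSTFT_apply (j r : ℕ) (z : ℂ) : hermiteSTFT j r z =
    cexp (-(Real.pi * I * (z.re * z.im))) * hermiteWigner j r (conj z) :=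
  congrFun (hermiteSTFT_eq j r) z

theorem memLp_hermiteSTFT (j r : ℕ) : MemLp (hermiteSTFT j r) 2 (volume : Measure ℂ) := by
  rw [hermiteSTFT_eq]; exact memLp_renormFun (memLp_hermiteWigner j r)

theorem orthonormal_hermiteWigner (r : ℕ) :
    Orthonormal ℂ fun j => (memLp_hermiteWigner j r).toLp (hermiteWigner j r) := by
  rw [orthonormal_iff_ite]
  intro i j
  rw [inner_toLp_toLp]
  have h := wignerPairing_eq i r j r
  rw [wignerPairing] at h
  simpa using h

theorem orthonormal_hermiteSTFT (r : ℕ) :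
    Orthonormal ℂ fun j => (memLp_hermiteSTFT j r).toLp (hermiteSTFT j r) := by
  have h := orthonormal_renormFun _ (orthonormal_hermiteWigner r)
  simpa only [← hermiteSTFT_eq] using h

theorem norm_hermiteSTFT (j r : ℕ) (z : ℂ) : ‖hermiteSTFT j r z‖ = ‖hermiteWigner j r (conj z)‖ := by
  rw [hermiteSTFT_eq, norm_renormFun]

theorem continuous_hermiteSTFT (j r : ℕ) : Continuous (hermiteSTFT j r) := by
  have h : Continuous fun z : ℂ => hermiteWigner j r (conj z) :=
    (continuous_hermiteWigner j r).comp Complex.continuous_conj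
  rw [funext (hermiteSTFT_apply j r)]
  exact Continuous.mul (by fun_prop) h

theorem conj_hermiteSTFT_mul (k j r : ℕ) (z : ℂ) :
    conj (hermiteSTFT k r z) * hermiteSTFT j r z =
      conj (hermiteWigner k r (conj z)) * hermiteWigner j r (conj z) := by
  have h : conj (cexp (-(Real.pi * I * (z.re * z.im)))) * cexp (-(Real.pi * I * (z.re * z.im)))
      = 1 := by
    rw [mul_comm, Complex.mul_conj, Complex.normSq_eq_norm_sq, norm_cexp_renorm]
    simp
  rw [hermiteSTFT_apply, hermiteSTFT_apply, map_mul]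
  linear_combination conj (hermiteWigner k r (conj z)) * hermiteWigner j r (conj z) * h

theorem hasSum_norm_sq_hermiteSTFT (r : ℕ) (z : ℂ) :
    HasSum (fun j => ‖hermiteSTFT j r z‖ ^ 2) 1 := by
  simpa only [norm_hermiteSTFT] using hasSum_norm_sq_hermiteWigner r (conj z)

theorem norm_hermiteSTFT_le_one (j r : ℕ) (z : ℂ) : ‖hermiteSTFT j r z‖ ≤ 1 := by
  rw [norm_hermiteSTFT]; exact norm_hermiteWigner_le_one _ _ _

/-- Covariance under time-frequency shifts: substituting t + x_w for t leaves a function of z - w up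
to a phase. -/
theorem whInfiniteKernel_hermiteFun (r : ℕ) (z w : ℂ) :
    whInfiniteKernel (hermiteFun r) z w =
      cexp (2 * Real.pi * I * (w.im - z.im) * w.re) * hermiteSTFT r r (z - w) := by
  rw [hermiteSTFT, stft, whInfiniteKernel, ← integral_const_mul,
    ← integral_add_right_eq_self _ w.re]
  congr 1
  ext t
  rw [add_sub_cancel_right, Complex.sub_re, show t + w.re - z.re = t - (z.re - w.re) by ring]
  have : cexp (2 * Real.pi * I * (w.im - z.im) * ((t + w.re : ℝ) : ℂ)) =
      cexp (2 * Real.pi * I * (w.im - z.im) * w.re) *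
        cexp (-2 * Real.pi * I * ((z - w).im : ℝ) * t) := by
    rw [← Complex.exp_add]
    congr 1
    rw [Complex.sub_im]
    push_cast
    ring
  rw [this]
  ring

/-- The kernel of the infinite Weyl-Heisenberg ensemble expands in the Hermite basis. -/
theorem hasSum_whInfiniteKernel (r : ℕ) (z w : ℂ) :
    HasSum (fun j => hermiteSTFT j r z * conj (hermiteSTFT j r w))
      (whInfiniteKernel (hermiteFun r) z w) := by
  have h := (hasSum_hermiteWigner r r (conj z) (conj w)).mul_left
    (cexp (-(Real.pi * I * (z.re * z.im))) * conj (cexp (-(Real.pi * I * (w.re * w.im)))))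
  convert! h using 1
  · ext j
    rw [hermiteSTFT_apply, hermiteSTFT_apply, map_mul]
    ring
  · rw [whInfiniteKernel_hermiteFun, hermiteSTFT_apply, shiftedWigner, map_sub, ← Complex.exp_conj]
    simp only [← mul_assoc]
    congr 1
    simp only [← Complex.exp_add]
    congr 1
    have hz := Complex.re_add_im z
    have hw := Complex.re_add_im w
    have hz' : conj z = z.re - z.im * I := by apply Complex.ext <;> simp
    have hw' : conj w = w.re - w.im * I := by apply Complex.ext <;> simp
    simp only [map_neg, map_mul, Complex.conj_ofReal, Complex.conj_I, Complex.sub_re,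
      Complex.sub_im, Complex.conj_conj]
    have hzw : conj z * w - z * conj w = 2 * I * (z.re * w.im - z.im * w.re) := by
      rw [hz', hw']
      nth_rw 3 [← hz]
      nth_rw 1 [← hw]
      ring
    rw [hzw]
    push_cast
    ring

theorem norm_whInfiniteKernel_le_one (r : ℕ) (z w : ℂ) :
    ‖whInfiniteKernel (hermiteFun r) z w‖ ≤ 1 := by
  have h : ‖cexp (2 * Real.pi * I * (w.im - z.im) * w.re)‖ = 1 := by
    rw [show (2 * Real.pi * I * (w.im - z.im) * w.re : ℂ) =
      ((2 * Real.pi * (w.im - z.im) * w.re : ℝ) : ℂ) * I by push_cast; ring,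
      Complex.norm_exp_ofReal_mul_I]
  rw [whInfiniteKernel_hermiteFun, norm_mul, h, one_mul]
  exact norm_hermiteSTFT_le_one _ _ _

end Orthogonality

/-! ### Sorting eigenvalues; diagonal operators as integral operators -/

section DiagonalOperators

open InnerProductSpace Filter

/-- A summable positive sequence admits a non-increasing rearrangement. -/
theorem exists_perm_antitone {mu : ℕ → ℝ} (hpos : ∀ j, 0 < mu j) (hs : Summable mu) :
    ∃ σ : Equiv.Perm ℕ, Antitone fun j => mu (σ j) := by
  classical
  -- Larger values come first, ties are broken by the index. Only finitely many indices precede a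
  -- given one because `mu` tends to zero, and counting them gives the new position.
  let before : ℕ → ℕ → Prop := fun k j => mu j < mu k ∨ (mu k = mu j ∧ k < j)
  have hfin : ∀ j, {k | before k j}.Finite := fun j => by
    have h := hs.tendsto_cofinite_zero.eventually (gt_mem_nhds (hpos j))
    refine (Filter.eventually_cofinite.mp h).subset fun k hk => ?_
    rcases hk with hk | hk
    · exact not_lt.mpr hk.le
    · exact not_lt.mpr hk.1.ge
  have htrans : ∀ {a b c}, before a b → before b c → before a c := by
    rintro a b c (h1 | h1) (h2 | h2)
    · exact Or.inl (h2.trans h1)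
    · exact Or.inl (h2.1 ▸ h1)
    · exact Or.inl (h1.1.symm ▸ h2)
    · exact Or.inr ⟨h1.1.trans h2.1, h1.2.trans h2.2⟩
  have hirr : ∀ a, ¬ before a a := fun a h => by
    rcases h with h | h
    · exact lt_irrefl _ h
    · exact lt_irrefl _ h.2
  have htot : ∀ {a b}, a ≠ b → before a b ∨ before b a := fun {a b} hab => by
    rcases lt_trichotomy (mu a) (mu b) with h | h | h
    · exact Or.inr (Or.inl h)
    · rcases lt_or_gt_of_ne hab with h' | h'
      · exact Or.inl (Or.inr ⟨h, h'⟩)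
      · exact Or.inr (Or.inr ⟨h.symm, h'⟩)
    · exact Or.inl (Or.inl h)
  let rank : ℕ → ℕ := fun j => (hfin j).toFinset.card
  have hlt : ∀ {a b}, before a b → rank a < rank b := fun {a b} hab => by
    refine Finset.card_lt_card ⟨fun k hk => ?_, fun hsub => ?_⟩
    · exact (hfin b).mem_toFinset.mpr (htrans ((hfin a).mem_toFinset.mp hk) hab)
    · have := hsub ((hfin b).mem_toFinset.mpr hab)
      exact hirr a ((hfin a).mem_toFinset.mp this)
  have hinj : Function.Injective rank := fun a b hab => by
    by_contra hne
    rcases htot hne with h | h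
    · exact (hlt h).ne hab
    · exact (hlt h).ne hab.symm
  have hsurj : Function.Surjective rank := fun n => by
    obtain ⟨j, hj⟩ : ∃ j, n < rank j := by
      by_contra! hcon
      exact Set.infinite_univ
        (((Set.finite_Iic n).preimage hinj.injOn).subset fun j _ => hcon j)
    -- The ranks of the predecessors of j are distinct and below `rank j`, so by counting they fill
    -- the whole initial segment.
    have himg : (hfin j).toFinset.image rank = Finset.range (rank j) := by
      refine Finset.eq_of_subset_of_card_le (fun m hm => ?_) ?_
      · obtain ⟨k, hk, rfl⟩ := Finset.mem_image.mp hm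
        exact Finset.mem_range.mpr (hlt ((hfin j).mem_toFinset.mp hk))
      · rw [Finset.card_range, Finset.card_image_of_injective _ hinj]
    obtain ⟨k, _, hk⟩ := Finset.mem_image.mp (himg ▸ Finset.mem_range.mpr hj)
    exact ⟨k, hk⟩
  refine ⟨(Equiv.ofBijective rank ⟨hinj, hsurj⟩).symm, fun n m hnm => ?_⟩
  by_contra! hcon
  have h1 := hlt (Or.inl hcon : before _ _)
  have h2 : ∀ m, rank ((Equiv.ofBijective rank ⟨hinj, hsurj⟩).symm m) = m := fun m =>
    Equiv.ofBijective_apply_symm_apply rank ⟨hinj, hsurj⟩ m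
  rw [h2, h2] at h1
  omega

/-- A series of integrable functions with summable integrals of norms has an integrable sum, and
may be integrated term by term. -/
theorem integrable_and_hasSum_integral_of_hasSum {α : Type*} [MeasurableSpace α] {μ : Measure α}
    {F : ℕ → α → ℂ} {f : α → ℂ} (hF : ∀ i, Integrable (F i) μ)
    (hs : Summable fun i => ∫ a, ‖F i a‖ ∂μ) (hf : ∀ᵐ a ∂μ, HasSum (fun i => F i a) (f a)) :
    Integrable f μ ∧ HasSum (fun i => ∫ a, F i a ∂μ) (∫ a, f a ∂μ) := by
  have htsum : ∀ᵐ a ∂μ, ∑' i, F i a = f a := hf.mono fun a ha => ha.tsum_eq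
  refine ⟨⟨?_, ?_⟩, ?_⟩
  · refine aestronglyMeasurable_of_tendsto_ae atTop
      (f := fun n a => ∑ i ∈ Finset.range n, F i a) (fun n => ?_)
      (hf.mono fun a ha => ha.tendsto_sum_nat)
    exact (integrable_finsetSum (Finset.range n) fun i _ => hF i).aestronglyMeasurable
  · have h1 : ∫⁻ a, ‖f a‖ₑ ∂μ ≤ ∑' i, ∫⁻ a, ‖F i a‖ₑ ∂μ := by
      rw [← lintegral_tsum fun i => (hF i).1.enorm]
      refine lintegral_mono_ae (htsum.mono fun a ha => ?_)
      rw [← ha]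
      exact enorm_tsum_le_tsum_enorm
    refine h1.trans_lt ?_
    have h2 : ∀ i, ∫⁻ a, ‖F i a‖ₑ ∂μ = ENNReal.ofReal (∫ a, ‖F i a‖ ∂μ) := fun i =>
      (ofReal_integral_norm_eq_lintegral_enorm (hF i)).symm
    simp only [h2]
    rw [← ENNReal.ofReal_tsum_of_nonneg
      (fun i => integral_nonneg fun a => norm_nonneg _) hs]
    exact ENNReal.ofReal_lt_top
  · have h := hasSum_integral_of_summable_integral_norm hF hs
    rwa [integral_congr_ae htsum] at h

variable {H : Type*} [NormedAddCommGroup H] [InnerProductSpace ℂ H] [CompleteSpace H]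

/-- The operator with prescribed summable eigenvalues on an orthonormal sequence. -/
noncomputable def diagonalOperator (e : ℕ → H) (mu : ℕ → ℝ) : H →L[ℂ] H :=
  ∑' j, (mu j : ℂ) • rankOne ℂ (e j) (e j)

theorem hasSum_diagonalOperator {e : ℕ → H} (he : Orthonormal ℂ e) {mu : ℕ → ℝ}
    (h0 : ∀ j, 0 ≤ mu j) (hs : Summable mu) (F : H) :
    HasSum (fun j => ((mu j : ℂ) * inner ℂ (e j) F) • e j) (diagonalOperator e mu F) := by
  have h : Summable fun j => (mu j : ℂ) • rankOne ℂ (e j) (e j) := by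
    refine Summable.of_norm ?_
    simpa [norm_smul, norm_rankOne, he.1, abs_of_nonneg (h0 _)] using hs
  have h2 := (ContinuousLinearMap.apply ℂ H F).hasSum h.hasSum
  convert! h2 using 1
  ext j
  simp [mul_smul]

/-- A summable diagonal operator is an integral operator. -/
theorem hasIntegralKernel_diagonalOperator {p : ℕ → ℂ → ℂ}
    (hp : ∀ j, MemLp (p j) 2 (volume : Measure ℂ))
    (ho : Orthonormal ℂ fun j => (hp j).toLp (p j)) (hb : ∀ j z, ‖p j z‖ ≤ 1)
    {mu : ℕ → ℝ} (h0 : ∀ j, 0 ≤ mu j) (hs : Summable mu) {K : ℂ → ℂ → ℂ}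
    (hK : ∀ z w, HasSum (fun j => mu j * (p j z * conj (p j w))) (K z w)) :
    HasIntegralKernel (diagonalOperator (fun j => (hp j).toLp (p j)) mu) K := by
  intro F
  set e := fun j => (hp j).toLp (p j) with he
  have hF := Lp.memLp F
  have hint : ∀ j, Integrable fun w => conj (p j w) * F w := fun j => integrable_conj_mul (hp j) hF
  have hnorm : ∀ j, ∫ w, ‖conj (p j w) * F w‖ ≤ 1 + ∫ w, ‖F w‖ ^ 2 := fun j => by
    have h1 : ∫ w, ‖p j w‖ ^ 2 = 1 := by
      have h2 := (orthonormal_iff_ite.mp ho) j j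
      rw [inner_toLp_toLp, if_pos rfl] at h2
      have h3 : ∀ w, conj (p j w) * p j w = ((‖p j w‖ ^ 2 : ℝ) : ℂ) := fun w => by
        rw [mul_comm, Complex.mul_conj, Complex.normSq_eq_norm_sq]
      simp only [h3] at h2
      rw [integral_complex_ofReal] at h2
      exact_mod_cast h2
    have hi1 := (memLp_two_iff_integrable_sq_norm (hp j).1).mp (hp j)
    have hi2 := (memLp_two_iff_integrable_sq_norm hF.1).mp hF
    rw [← h1, ← integral_add hi1 hi2]
    refine integral_mono (hint j).norm (hi1.add hi2) fun w => ?_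
    simp only [norm_mul, Complex.norm_conj]
    nlinarith [sq_nonneg (‖p j w‖ - ‖F w‖), sq_nonneg (‖p j w‖), sq_nonneg (‖F w‖)]
  -- Convergence in L² gives pointwise convergence only along a subsequence. That suffices, since
  -- for every z the series of integrals converges to the kernel integral.
  have hae := (tendstoInMeasure_of_tendsto_Lp
    (hasSum_diagonalOperator ho h0 hs F).tendsto_sum_nat).exists_seq_tendsto_ae
  obtain ⟨ns, hns, hlim⟩ := hae
  have hcoe : ∀ᵐ z, ∀ n : ℕ, (∑ j ∈ Finset.range n, ((mu j : ℂ) * inner ℂ (e j) F) • e j :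
      Lp ℂ 2 (volume : Measure ℂ)) z = ∑ j ∈ Finset.range n, ((mu j : ℂ) * inner ℂ (e j) F) * p j z := by
    rw [ae_all_iff]
    intro n
    have h1 : ∀ᵐ z, ∀ j : ℕ, ((((mu j : ℂ) * inner ℂ (e j) F) • e j :
        Lp ℂ 2 (volume : Measure ℂ)) : ℂ → ℂ) z = ((mu j : ℂ) * inner ℂ (e j) F) * p j z := by
      rw [ae_all_iff]
      intro j
      filter_upwards [Lp.coeFn_smul ((mu j : ℂ) * inner ℂ (e j) F) (e j), (hp j).coeFn_toLp]
        with z hz1 hz2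
      rw [hz1, Pi.smul_apply, hz2, smul_eq_mul]
    filter_upwards [h1, Lp.coeFn_finsetSum (Finset.range n)
      fun j => ((mu j : ℂ) * inner ℂ (e j) F) • e j] with z hz1 hz2
    rw [hz2, Finset.sum_apply]
    exact Finset.sum_congr rfl fun j _ => hz1 j
  filter_upwards [hlim, hcoe] with z hz1 hz2
  have hG := integrable_and_hasSum_integral_of_hasSum (μ := (volume : Measure ℂ))
    (F := fun j w => (mu j * p j z) * (conj (p j w) * F w)) (f := fun w => K z w * F w)
    (fun j => (hint j).const_mul _) ?_ (Eventually.of_forall fun w => ?_)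
  · refine ⟨hG.1, tendsto_nhds_unique hz1 ?_⟩
    have h2 := hG.2.tendsto_sum_nat.comp hns.tendsto_atTop
    refine h2.congr fun n => ?_
    rw [hz2]
    refine Finset.sum_congr rfl fun j _ => ?_
    rw [integral_const_mul, he, inner_toLp_left]
    ring
  · refine Summable.of_nonneg_of_le (fun j => integral_nonneg fun w => norm_nonneg _) (fun j => ?_)
      (hs.mul_right (1 + ∫ w, ‖F w‖ ^ 2))
    simp only [norm_mul (_ * _ : ℂ) (_ * _), integral_const_mul]
    refine mul_le_mul ?_ (hnorm j) (integral_nonneg fun w => norm_nonneg _) (h0 j)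
    rw [norm_mul, Complex.norm_real, Real.norm_of_nonneg (h0 j)]
    exact mul_le_of_le_one_right (h0 j) (hb j z)
  · convert! (hK z w).mul_right (F w) using 1
    ext j
    ring

end DiagonalOperators

/-! ### The Toeplitz operator of a disk in the Hermite basis -/

section ToeplitzDisk

open Filter

theorem measurableSet_disk (R : ℝ) : MeasurableSet (disk R) := measurableSet_closedBall

theorem circle_mul_mem_disk (R : ℝ) (c : Circle) (z : ℂ) : c * z ∈ disk R ↔ z ∈ disk R := by
  rw [disk, mem_closedBall_zero_iff, mem_closedBall_zero_iff, norm_mul, Circle.norm_coe, one_mul]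

theorem conj_mem_disk (R : ℝ) (z : ℂ) : conj z ∈ disk R ↔ z ∈ disk R := by
  simp [disk]

theorem volume_disk (R : ℝ) (hR : 0 < R) : (volume (disk R)).toReal = Real.pi * R ^ 2 := by
  rw [disk, Complex.volume_closedBall, ENNReal.toReal_mul, ENNReal.toReal_pow,
    ENNReal.toReal_ofReal hR.le]
  simp [mul_comm]

theorem isFiniteMeasure_disk (R : ℝ) : IsFiniteMeasure (volume.restrict (disk R)) :=
  ⟨by rw [Measure.restrict_apply_univ]; exact measure_closedBall_lt_top⟩

/-- The eigenvalues of the Toeplitz operator of a disk with Hermite window. -/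
noncomputable def toeplitzEigenvalue (r : ℕ) (R : ℝ) (j : ℕ) : ℝ :=
  ∫ z in disk R, ‖hermiteSTFT j r z‖ ^ 2

theorem integrable_norm_sq_hermiteSTFT (j r : ℕ) :
    Integrable fun z => ‖hermiteSTFT j r z‖ ^ 2 :=
  (memLp_two_iff_integrable_sq_norm (memLp_hermiteSTFT j r).1).mp (memLp_hermiteSTFT j r)

theorem integral_norm_sq_hermiteSTFT (j r : ℕ) : ∫ z, ‖hermiteSTFT j r z‖ ^ 2 = 1 := by
  have h2 := (orthonormal_iff_ite.mp (orthonormal_hermiteSTFT r)) j j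
  rw [inner_toLp_toLp, if_pos rfl] at h2
  have h3 : ∀ w, conj (hermiteSTFT j r w) * hermiteSTFT j r w =
      ((‖hermiteSTFT j r w‖ ^ 2 : ℝ) : ℂ) := fun w => by
    rw [mul_comm, Complex.mul_conj, Complex.normSq_eq_norm_sq]
  simp only [h3] at h2
  rw [integral_complex_ofReal] at h2
  exact_mod_cast h2

theorem toeplitzEigenvalue_nonneg (r : ℕ) (R : ℝ) (j : ℕ) : 0 ≤ toeplitzEigenvalue r R j :=
  integral_nonneg fun _ => sq_nonneg _

theorem toeplitzEigenvalue_le_one (r : ℕ) (R : ℝ) (j : ℕ) : toeplitzEigenvalue r R j ≤ 1 := by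
  rw [← integral_norm_sq_hermiteSTFT j r]
  exact setIntegral_le_integral (integrable_norm_sq_hermiteSTFT j r)
    (Eventually.of_forall fun _ => sq_nonneg _)

/-- Near the origin the Laguerre factors stay close to their values at 0, which are positive
binomial coefficients, and powers of z or z̄ vanish only at 0. The resulting positivity of every
eigenvalue is what makes σ a bijection onto all indices. -/
theorem exists_hermiteWigner_ne_zero (j r : ℕ) {R : ℝ} (hR : 0 < R) :
    ∃ z : ℂ, ‖z‖ < R ∧ hermiteWigner j r z ≠ 0 := by
  have hlag : ∀ k a, laguerre k a 0 ≠ 0 := fun k a => by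
    rw [laguerre, Finset.sum_range_succ']
    simp [(Nat.choose_pos (Nat.le_add_right k a)).ne']
  have hev : ∀ k a, ∀ᶠ z : ℂ in nhdsWithin 0 {0}ᶜ, laguerre k a (Real.pi * ‖z‖ ^ 2) ≠ 0 :=
    fun k a => by
      have hc : ContinuousAt (fun z : ℂ => laguerre k a (Real.pi * ‖z‖ ^ 2)) 0 :=
        ((continuous_laguerre k a).comp (by fun_prop)).continuousAt
      exact (hc.eventually_ne (by simpa using hlag k a)).filter_mono nhdsWithin_le_nhds
  have hball : ∀ᶠ z : ℂ in nhdsWithin 0 {0}ᶜ, ‖z‖ < R := by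
    have : ∀ᶠ z : ℂ in nhds 0, ‖z‖ < R := by
      filter_upwards [Metric.ball_mem_nhds (0 : ℂ) hR] with z hz using by simpa using hz
    exact this.filter_mono nhdsWithin_le_nhds
  obtain ⟨z, h1, h2, h3, h4⟩ := (hball.and ((hev r (j - r)).and ((hev j (r - j)).and
    self_mem_nhdsWithin))).exists
  have hz : z ≠ 0 := h4
  refine ⟨z, h1, ?_⟩
  rw [hermiteWigner_eq]
  refine mul_ne_zero ?_ (by exact_mod_cast (Real.exp_pos _).ne')
  have hj : (j ! : ℝ) ≠ 0 := Nat.cast_ne_zero.mpr (Nat.factorial_ne_zero j)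
  have hr : (r ! : ℝ) ≠ 0 := Nat.cast_ne_zero.mpr (Nat.factorial_ne_zero r)
  have hp : √Real.pi ≠ 0 := (Real.sqrt_pos.mpr Real.pi_pos).ne'
  have hjr : √((j ! : ℝ) / r !) ≠ 0 := (Real.sqrt_pos.mpr (by positivity)).ne'
  have hrj : √((r ! : ℝ) / j !) ≠ 0 := (Real.sqrt_pos.mpr (by positivity)).ne'
  rw [complexHermite]
  split_ifs
  · refine mul_ne_zero (mul_ne_zero ?_ (pow_ne_zero _ hz)) (by exact_mod_cast h2)
    exact Complex.ofReal_ne_zero.mpr (mul_ne_zero hrj (pow_ne_zero _ hp))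
  · refine mul_ne_zero (mul_ne_zero ?_ (pow_ne_zero _ ?_)) (by exact_mod_cast h3)
    · exact Complex.ofReal_ne_zero.mpr
        (mul_ne_zero (mul_ne_zero (pow_ne_zero _ (by norm_num)) hjr) (pow_ne_zero _ hp))
    · simpa using hz

theorem toeplitzEigenvalue_pos (r : ℕ) {R : ℝ} (hR : 0 < R) (j : ℕ) :
    0 < toeplitzEigenvalue r R j := by
  rw [toeplitzEigenvalue, setIntegral_pos_iff_support_of_nonneg_ae
    (Eventually.of_forall fun _ => sq_nonneg _) (integrable_norm_sq_hermiteSTFT j r).integrableOn]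
  obtain ⟨z, hz, hne⟩ := exists_hermiteWigner_ne_zero j r hR
  have hopen : IsOpen ({u : ℂ | hermiteSTFT j r u ≠ 0} ∩ Metric.ball 0 R) :=
    (isOpen_ne_fun (continuous_hermiteSTFT j r) continuous_const).inter Metric.isOpen_ball
  refine (hopen.measure_pos volume ⟨conj z, ?_, by simpa using hz⟩).trans_le (measure_mono ?_)
  · change hermiteSTFT j r (conj z) ≠ 0
    rw [← norm_pos_iff, norm_hermiteSTFT, Complex.conj_conj]
    exact norm_pos_iff.mpr hne
  · rintro u ⟨hu1, hu2⟩
    refine ⟨?_, Metric.ball_subset_closedBall hu2⟩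
    simpa [Function.mem_support] using hu1

theorem hasSum_toeplitzEigenvalue (r : ℕ) {R : ℝ} (hR : 0 < R) :
    HasSum (toeplitzEigenvalue r R) (Real.pi * R ^ 2) := by
  have := isFiniteMeasure_disk R
  have hi : ∀ j, Integrable (fun z => ‖hermiteSTFT j r z‖ ^ 2) (volume.restrict (disk R)) :=
    fun j => (integrable_norm_sq_hermiteSTFT j r).integrableOn
  have hs : Summable (toeplitzEigenvalue r R) := by
    refine summable_of_sum_range_le (c := ∫ _ in disk R, (1 : ℝ))
      (toeplitzEigenvalue_nonneg r R) fun n => ?_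
    simp only [toeplitzEigenvalue]
    rw [← integral_finsetSum _ fun j _ => hi j]
    refine integral_mono (integrable_finsetSum _ fun j _ => hi j) (integrable_const _) fun z => ?_
    exact sum_le_hasSum _ (fun _ _ => sq_nonneg _) (hasSum_norm_sq_hermiteSTFT r z)
  have h := hasSum_integral_of_summable_integral_norm hi (by
    simp only [Real.norm_of_nonneg (sq_nonneg _)]
    exact hs)
  simp only [(hasSum_norm_sq_hermiteSTFT r _).tsum_eq] at h
  rw [integral_const, smul_eq_mul, mul_one, Measure.real, Measure.restrict_apply_univ,
    volume_disk R hR] at h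
  exact h

theorem summable_toeplitzEigenvalue (r : ℕ) {R : ℝ} (hR : 0 < R) :
    Summable (toeplitzEigenvalue r R) := (hasSum_toeplitzEigenvalue r hR).summable

/-- Rotation invariance of the disk enters here: it makes the basis orthogonal on D, not only on the
plane. -/
theorem setIntegral_conj_hermiteSTFT_mul (r : ℕ) (R : ℝ) (k j : ℕ) :
    ∫ z in disk R, conj (hermiteSTFT k r z) * hermiteSTFT j r z =
      if k = j then (toeplitzEigenvalue r R j : ℂ) else 0 := by
  split_ifs with h
  · subst h
    have h3 : ∀ w, conj (hermiteSTFT k r w) * hermiteSTFT k r w =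
        ((‖hermiteSTFT k r w‖ ^ 2 : ℝ) : ℂ) := fun w => by
      rw [mul_comm, Complex.mul_conj, Complex.normSq_eq_norm_sq]
    simp only [h3]
    rw [integral_complex_ofReal, toeplitzEigenvalue]
  · simp only [conj_hermiteSTFT_mul]
    have h2 := measurePreserving_conj.setIntegral_preimage_emb measurableEmbedding_conj
      (fun z => conj (hermiteWigner k r z) * hermiteWigner j r z) (disk R)
    have h3 : (fun z : ℂ => conj z) ⁻¹' disk R = disk R := by
      ext z
      exact conj_mem_disk R z
    rw [h3, setIntegral_conj_hermiteWigner_mul (circle_mul_mem_disk R) h r] at h2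
    exact h2

theorem conj_whInfiniteKernel (r : ℕ) (z w : ℂ) :
    conj (whInfiniteKernel (hermiteFun r) z w) = whInfiniteKernel (hermiteFun r) w z := by
  have h := Complex.hasSum_conj'.mpr (hasSum_whInfiniteKernel r z w)
  refine h.unique ?_
  simpa [mul_comm] using hasSum_whInfiniteKernel r w z

theorem continuous_whInfiniteKernel_left (r : ℕ) (w : ℂ) :
    Continuous fun u => whInfiniteKernel (hermiteFun r) u w := by
  have h : Continuous fun u => hermiteSTFT r r (u - w) :=
    (continuous_hermiteSTFT r r).comp (by fun_prop)
  simp only [whInfiniteKernel_hermiteFun]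
  exact Continuous.mul (by fun_prop) h

/-- The reproducing kernel may be integrated term by term over a disk. -/
theorem hasSum_setIntegral_whInfiniteKernel_mul (r : ℕ) {R : ℝ} (hR : 0 < R) (z : ℂ) {b : ℂ → ℂ}
    (hb : Continuous b) (hb1 : ∀ u, ‖b u‖ ≤ 1) :
    HasSum (fun j => hermiteSTFT j r z * ∫ u in disk R, conj (hermiteSTFT j r u) * b u)
      (∫ u in disk R, whInfiniteKernel (hermiteFun r) z u * b u) := by
  have := isFiniteMeasure_disk R
  have hint : ∀ j, Integrable (fun u => hermiteSTFT j r z * (conj (hermiteSTFT j r u) * b u))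
      (volume.restrict (disk R)) := fun j => by
    refine Integrable.of_bound (C := 1) ?_ (Eventually.of_forall fun u => ?_)
    · exact (continuous_const.mul ((Complex.continuous_conj.comp
        (continuous_hermiteSTFT j r)).mul hb)).aestronglyMeasurable
    · rw [norm_mul, norm_mul, Complex.norm_conj]
      exact mul_le_one₀ (norm_hermiteSTFT_le_one j r z) (by positivity)
        (mul_le_one₀ (norm_hermiteSTFT_le_one j r u) (norm_nonneg _) (hb1 u))
  have h := (integrable_and_hasSum_integral_of_hasSum hint ?_ (Eventually.of_forall fun u => by
    have := (hasSum_whInfiniteKernel r z u).mul_right (b u)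
    simpa only [mul_assoc] using this)).2
  · simpa only [integral_const_mul] using h
  · refine Summable.of_nonneg_of_le (fun j => integral_nonneg fun u => norm_nonneg _) (fun j => ?_)
      -- The majorant comes from ab ≤ a² + b² with a = |V_j(z)| and b = |V_j(u)|: the first square
      -- is summable at fixed z, the second after integration over the disk.
      (((hasSum_norm_sq_hermiteSTFT r z).summable.mul_right (Real.pi * R ^ 2)).add
        (summable_toeplitzEigenvalue r hR))
    have h1 : ‖hermiteSTFT j r z‖ ^ 2 * (Real.pi * R ^ 2) =
        ∫ _ in disk R, ‖hermiteSTFT j r z‖ ^ 2 := by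
      rw [integral_const, smul_eq_mul, Measure.real, Measure.restrict_apply_univ,
        volume_disk R hR, mul_comm]
    rw [h1, toeplitzEigenvalue, ← integral_add (integrable_const _)
      (integrable_norm_sq_hermiteSTFT j r).integrableOn]
    refine integral_mono (hint j).norm ((integrable_const _).add
      (integrable_norm_sq_hermiteSTFT j r).integrableOn) fun u => ?_
    simp only [norm_mul, Complex.norm_conj]
    have h2 : ‖hermiteSTFT j r z‖ * (‖hermiteSTFT j r u‖ * ‖b u‖) ≤
        ‖hermiteSTFT j r z‖ * ‖hermiteSTFT j r u‖ :=
      mul_le_mul_of_nonneg_left (mul_le_of_le_one_right (norm_nonneg _) (hb1 u)) (norm_nonneg _)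
    refine h2.trans ?_
    nlinarith [sq_nonneg (‖hermiteSTFT j r z‖ - ‖hermiteSTFT j r u‖),
      sq_nonneg (‖hermiteSTFT j r z‖), sq_nonneg (‖hermiteSTFT j r u‖)]

/-- Expand the kernel in the Hermite basis; orthogonality on the disk leaves a single term. The
conjugate of this identity is the eigenvalue equation. -/
theorem setIntegral_conj_hermiteSTFT_mul_whInfiniteKernel (r : ℕ) {R : ℝ} (hR : 0 < R) (j : ℕ)
    (w : ℂ) : ∫ u in disk R, conj (hermiteSTFT j r u) * whInfiniteKernel (hermiteFun r) u w =
      toeplitzEigenvalue r R j * conj (hermiteSTFT j r w) := by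
  have h := hasSum_setIntegral_whInfiniteKernel_mul r hR w (continuous_hermiteSTFT j r)
    (norm_hermiteSTFT_le_one j r)
  simp only [setIntegral_conj_hermiteSTFT_mul] at h
  have h2 := hasSum_single (f := fun k => hermiteSTFT k r w *
    if k = j then (toeplitzEigenvalue r R j : ℂ) else 0) j fun k hk => by simp [hk]
  have h3 := congrArg conj (h.unique h2)
  rw [← integral_conj] at h3
  simp only [map_mul, conj_whInfiniteKernel, if_true, Complex.conj_ofReal] at h3
  rw [mul_comm (toeplitzEigenvalue r R j : ℂ), ← h3]
  congr 1
  ext u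
  ring

theorem hasSum_toeplitzKernel (r : ℕ) {R : ℝ} (hR : 0 < R) (z w : ℂ) :
    HasSum (fun j => toeplitzEigenvalue r R j * (hermiteSTFT j r z * conj (hermiteSTFT j r w)))
      (toeplitzKernel (hermiteFun r) (disk R) z w) := by
  have h := hasSum_setIntegral_whInfiniteKernel_mul r hR z (continuous_whInfiniteKernel_left r w)
    fun u => norm_whInfiniteKernel_le_one r u w
  simp only [setIntegral_conj_hermiteSTFT_mul_whInfiniteKernel r hR] at h
  convert! h using 1
  ext j
  ring

/-- The Toeplitz operator of a disk with Hermite window is diagonal in the Hermite basis. -/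
noncomputable def toeplitzOperator (r : ℕ) (R : ℝ) :
    Lp ℂ 2 (volume : Measure ℂ) →L[ℂ] Lp ℂ 2 (volume : Measure ℂ) :=
  diagonalOperator (fun j => (memLp_hermiteSTFT j r).toLp (hermiteSTFT j r))
    (toeplitzEigenvalue r R)

theorem hasIntegralKernel_toeplitzOperator (r : ℕ) {R : ℝ} (hR : 0 < R) :
    HasIntegralKernel (toeplitzOperator r R) (toeplitzKernel (hermiteFun r) (disk R)) :=
  hasIntegralKernel_diagonalOperator (fun j => memLp_hermiteSTFT j r) (orthonormal_hermiteSTFT r)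
    (fun j => norm_hermiteSTFT_le_one j r) (toeplitzEigenvalue_nonneg r R)
    (summable_toeplitzEigenvalue r hR) (hasSum_toeplitzKernel r hR)

theorem hasSum_toeplitzOperator (r : ℕ) {R : ℝ} (hR : 0 < R) (F : Lp ℂ 2 (volume : Measure ℂ)) :
    HasSum (fun j => ((toeplitzEigenvalue r R j : ℂ) *
      inner ℂ ((memLp_hermiteSTFT j r).toLp (hermiteSTFT j r)) F) •
        (memLp_hermiteSTFT j r).toLp (hermiteSTFT j r)) (toeplitzOperator r R F) :=
  hasSum_diagonalOperator (orthonormal_hermiteSTFT r) (toeplitzEigenvalue_nonneg r R)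
    (summable_toeplitzEigenvalue r hR) F

/-- Identifies the operator of an arbitrary eigen-expansion with `toeplitzOperator`, so that both
diagonalizations share one quadratic form. -/
theorem hasIntegralKernel_unique
    {S T : Lp ℂ 2 (volume : Measure ℂ) →L[ℂ] Lp ℂ 2 (volume : Measure ℂ)} {K : ℂ → ℂ → ℂ}
    (hS : HasIntegralKernel S K) (hT : HasIntegralKernel T K) : S = T := by
  ext1 F
  refine Lp.ext ?_
  filter_upwards [hS F, hT F] with z h1 h2
  rw [h1.2, h2.2]

theorem exists_isToeplitzExpansion (r : ℕ) {R : ℝ} (hR : 0 < R) :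
    ∃ (lam : ℕ → ℝ) (p : ℕ → ℂ → ℂ) (σ : Equiv.Perm ℕ),
      IsToeplitzExpansion (hermiteFun r) (disk R) lam p ∧
      ∀ (j : ℕ) (z : ℂ), renormFun (p j) z =
        complexHermite (σ j) r z * (Real.exp (-(Real.pi / 2) * ‖z‖ ^ 2) : ℂ) := by
  obtain ⟨σ, hσ⟩ := exists_perm_antitone (toeplitzEigenvalue_pos r hR)
    (summable_toeplitzEigenvalue r hR)
  refine ⟨fun j => toeplitzEigenvalue r R (σ j), fun j => hermiteSTFT (σ j) r, σ, ?_, fun j z => ?_⟩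
  · exact
    { lam_pos := fun j => toeplitzEigenvalue_pos r hR _
      lam_antitone := hσ
      mem_range := fun j => ⟨hermiteFun (σ j), memLp_hermiteFun _, rfl⟩
      memLp := fun j => memLp_hermiteSTFT _ r
      orthonormal := (orthonormal_hermiteSTFT r).comp σ σ.injective
      expansion := ⟨toeplitzOperator r R, hasIntegralKernel_toeplitzOperator r hR, fun F =>
        (σ.hasSum_iff (f := fun j => ((toeplitzEigenvalue r R j : ℂ) *
          inner ℂ ((memLp_hermiteSTFT j r).toLp (hermiteSTFT j r)) F) •
          (memLp_hermiteSTFT j r).toLp (hermiteSTFT j r))).mpr (hasSum_toeplitzOperator r hR F)⟩ }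
  · rw [← hermiteWigner_eq]
    rfl

end ToeplitzDisk

/-! ### The tail of the eigenvalue sum is O(√N) -/

section TailEstimate

theorem setIntegral_disk_norm {R : ℝ} (hR : 0 < R) (g : ℝ → ℝ) :
    ∫ z in disk R, g ‖z‖ = 2 * Real.pi * ∫ y in (0 : ℝ)..R, y * g y := by
  have h := integral_fun_norm_addHaar (volume : Measure ℂ) ((Set.Iic R).indicator g)
  have h1 : ∫ z in disk R, g ‖z‖ = ∫ z : ℂ, (Set.Iic R).indicator g ‖z‖ := by
    rw [← integral_indicator (measurableSet_disk R)]
    congr 1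
    ext z
    have hm : z ∈ disk R ↔ ‖z‖ ∈ Set.Iic R := mem_closedBall_zero_iff
    by_cases hz : z ∈ disk R
    · rw [Set.indicator_of_mem hz, Set.indicator_of_mem (hm.mp hz)]
    · rw [Set.indicator_of_notMem hz, Set.indicator_of_notMem (mt hm.mpr hz)]
  have h2 : ∀ y, y ^ (2 - 1) • (Set.Iic R).indicator g y =
      (Set.Iic R).indicator (fun y => y * g y) y := fun y => by
    simp [Set.indicator_apply]
  rw [h1, h, Complex.finrank_real_complex]
  simp only [h2]
  rw [setIntegral_indicator measurableSet_Iic, Set.Ioi_inter_Iic,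
    intervalIntegral.integral_of_le hR.le, Measure.real, Complex.volume_ball]
  simp
  ring

/-- In polar coordinates the integrand is the derivative of (K/π) arctan((πy² - N)/K), and arctan
varies by less than π; the angular factor 2π gives 2πK. -/
theorem setIntegral_disk_arctan_le {R K : ℝ} (hR : 0 < R) (hK : 0 < K) (N : ℝ) :
    ∫ z in disk R, 2 / (1 + ((Real.pi * ‖z‖ ^ 2 - N) / K) ^ 2) ≤ 2 * Real.pi * K := by
  rw [setIntegral_disk_norm hR fun y => 2 / (1 + ((Real.pi * y ^ 2 - N) / K) ^ 2)]
  have hpos : ∀ y : ℝ, 0 < 1 + ((Real.pi * y ^ 2 - N) / K) ^ 2 := fun y => by positivity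
  have hderiv : ∀ y ∈ Set.uIcc 0 R, HasDerivAt
      (fun y : ℝ => K / Real.pi * Real.arctan ((Real.pi * y ^ 2 - N) / K))
      (y * (2 / (1 + ((Real.pi * y ^ 2 - N) / K) ^ 2))) y := fun y _ => by
    have h1 : HasDerivAt (fun y : ℝ => (Real.pi * y ^ 2 - N) / K) (Real.pi * (2 * y) / K) y := by
      have := ((((hasDerivAt_id y).pow 2).const_mul Real.pi).sub_const N).div_const K
      simpa using this
    convert! h1.arctan.const_mul (K / Real.pi) using 1
    have := Real.pi_ne_zero
    have := (hpos y).ne'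
    field_simp
  have hcont : Continuous fun y : ℝ => y * (2 / (1 + ((Real.pi * y ^ 2 - N) / K) ^ 2)) :=
    continuous_id.mul (continuous_const.div (by fun_prop) fun y => (hpos y).ne')
  rw [intervalIntegral.integral_eq_sub_of_hasDerivAt hderiv (hcont.intervalIntegrable _ _)]
  have h1 := Real.arctan_lt_pi_div_two ((Real.pi * R ^ 2 - N) / K)
  have h2 := Real.neg_pi_div_two_lt_arctan ((Real.pi * 0 ^ 2 - N) / K)
  have h3 : 2 * Real.pi * (K / Real.pi * Real.arctan ((Real.pi * R ^ 2 - N) / K) -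
      K / Real.pi * Real.arctan ((Real.pi * 0 ^ 2 - N) / K)) =
      2 * K * (Real.arctan ((Real.pi * R ^ 2 - N) / K) -
        Real.arctan ((Real.pi * 0 ^ 2 - N) / K)) := by
    have := Real.pi_ne_zero
    field_simp
  rw [h3, show 2 * Real.pi * K = 2 * K * Real.pi by ring]
  refine mul_le_mul_of_nonneg_left ?_ (by positivity)
  linarith

theorem toeplitzEigenvalue_tail_le (r N : ℕ) {R : ℝ} (hR : 0 < R) (hN : 1 ≤ N)
    (hRN : Real.pi * R ^ 2 ≤ N) :
    Real.pi * R ^ 2 - ∑ j ∈ Finset.range N, toeplitzEigenvalue r R j ≤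
      2 * Real.pi * √(3 * (r + 1) ^ 2 * N) := by
  have hfin := isFiniteMeasure_disk R
  have hK : 0 < √(3 * ((r : ℝ) + 1) ^ 2 * N) := by
    have : (0 : ℝ) < N := by exact_mod_cast hN
    positivity
  have hs := summable_toeplitzEigenvalue r hR
  have h1 := hs.sum_add_tsum_nat_add N
  rw [(hasSum_toeplitzEigenvalue r hR).tsum_eq] at h1
  rw [← h1, add_sub_cancel_left]
  refine ((summable_nat_add_iff N).mpr hs).tsum_le_of_sum_range_le fun m => ?_
  refine le_trans ?_ (setIntegral_disk_arctan_le hR hK N)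
  simp only [toeplitzEigenvalue]
  rw [← integral_finsetSum _ fun j _ => (integrable_norm_sq_hermiteSTFT _ r).integrableOn]
  have hcont : Continuous fun z : ℂ =>
      2 / (1 + ((Real.pi * ‖z‖ ^ 2 - N) / √(3 * ((r : ℝ) + 1) ^ 2 * N)) ^ 2) :=
    continuous_const.div (by fun_prop) fun z => by positivity
  refine setIntegral_mono_on
    (integrable_finsetSum _ fun j _ => (integrable_norm_sq_hermiteSTFT _ r).integrableOn)
    (hcont.continuousOn.integrableOn_compact (isCompact_closedBall 0 R)) (measurableSet_disk R)
    fun z hz => ?_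
  have hz' : ‖z‖ ≤ R := by simpa [disk] using hz
  have hzN : Real.pi * ‖conj z‖ ^ 2 ≤ N := by
    rw [Complex.norm_conj]
    refine le_trans ?_ hRN
    gcongr
  have h2 := sum_tail_norm_sq_hermiteWigner_le r N hN (conj z) hzN
    ((Finset.range m).map (addRightEmbedding N)) (fun j hj => by
      obtain ⟨k, _, rfl⟩ := Finset.mem_map.mp hj
      simp)
  simp only [Finset.sum_map, addRightEmbedding_apply, ← norm_hermiteSTFT, Complex.norm_conj] at h2
  exact h2

/-- The left side is 2(N - πR²) plus four times the tail. Rounding up costs less than 1, and the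
resulting constant 2 is absorbed by √N ≥ 1. -/
theorem traceNorm_bound_le (r N : ℕ) {R : ℝ} (hR : 0 < R) (hN : whNumber (disk R) = N) :
    2 * (N + ∑' j, toeplitzEigenvalue r R j -
      2 * ∑ j ∈ Finset.range N, toeplitzEigenvalue r R j) ≤
      (2 + 8 * Real.pi * (√3 * (r + 1))) * √N := by
  rw [whNumber, volume_disk R hR] at hN
  have hpos : 0 < Real.pi * R ^ 2 := by positivity
  have hN1 : 1 ≤ N := by rw [← hN]; exact Nat.one_le_ceil_iff.mpr hpos
  have hle : Real.pi * R ^ 2 ≤ N := by rw [← hN]; exact Nat.le_ceil _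
  have hlt : (N : ℝ) < Real.pi * R ^ 2 + 1 := by rw [← hN]; exact Nat.ceil_lt_add_one hpos.le
  have htail := toeplitzEigenvalue_tail_le r N hR hN1 hle
  have hsqrt : √(3 * ((r : ℝ) + 1) ^ 2 * N) = √3 * (r + 1) * √N := by
    rw [Real.sqrt_mul (by positivity), Real.sqrt_mul (by positivity), Real.sqrt_sq (by positivity)]
  rw [hsqrt] at htail
  rw [(hasSum_toeplitzEigenvalue r hR).tsum_eq]
  have h1 : 1 ≤ √(N : ℝ) := by
    rw [Real.one_le_sqrt]
    exact_mod_cast hN1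
  nlinarith

end TailEstimate

/-! ### Comparing the perimeter with √N -/

section Perimeter

theorem frontier_disk {R : ℝ} (hR : 0 < R) : frontier (disk R) = Metric.sphere 0 R :=
  frontier_closedBall 0 hR.ne'

theorem perimeter_disk_le {R : ℝ} (hR : 0 < R) :
    perimeter (disk R) ≤ ENNReal.ofReal (2 * Real.pi * R) := by
  rw [perimeter, frontier_disk hR, ← abs_of_pos hR, ← image_circleMap_Ioc 0 R]
  refine ((lipschitzWith_circleMap 0 R).hausdorffMeasure_image_le zero_le_one _).trans ?_
  rw [hausdorffMeasure_real, Real.volume_Ioc, ENNReal.rpow_one, sub_zero,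
    mul_comm (2 * Real.pi), ENNReal.ofReal_mul (abs_nonneg _)]
  refine le_of_eq ?_
  congr 1
  rw [← Real.coe_nnabs, ENNReal.ofReal_coe_nnreal]

/-- Projection to the real axis is 1-Lipschitz and maps the circle onto a set containing [-R, R].
The bound 2R loses a factor π, which is irrelevant for the comparison. -/
theorem le_perimeter_disk {R : ℝ} (hR : 0 < R) :
    ENNReal.ofReal (2 * R) ≤ perimeter (disk R) := by
  rw [perimeter, frontier_disk hR]
  have hlip : LipschitzWith 1 Complex.re := LipschitzWith.of_dist_le_mul fun z w => by
    rw [NNReal.coe_one, one_mul, Real.dist_eq, Complex.dist_eq, ← Complex.sub_re]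
    exact Complex.abs_re_le_norm _
  have h := hlip.hausdorffMeasure_image_le zero_le_one (Metric.sphere 0 R)
  rw [hausdorffMeasure_real, ENNReal.coe_one, ENNReal.one_rpow, one_mul] at h
  refine le_trans ?_ h
  have hsub : Set.Icc (-R) R ⊆ Complex.re '' Metric.sphere 0 R := fun x hx => by
    have hx2 : 0 ≤ R ^ 2 - x ^ 2 := by nlinarith [hx.1, hx.2]
    refine ⟨⟨x, √(R ^ 2 - x ^ 2)⟩, ?_, rfl⟩
    rw [mem_sphere_zero_iff_norm, ← sq_eq_sq₀ (norm_nonneg _) hR.le, Complex.sq_norm,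
      Complex.normSq_mk, Real.mul_self_sqrt hx2]
    ring
  refine le_trans (le_of_eq ?_) (measure_mono hsub)
  rw [Real.volume_Icc]
  congr 1
  ring

theorem sqrt_whNumber_disk_le {R : ℝ} (hR : 0 < R) (h1 : 1 ≤ perimeter (disk R)) :
    √(whNumber (disk R) : ℝ) ≤ 7 * (2 * R) := by
  -- A perimeter of at least 1 keeps R away from 0, where N = 1 but the perimeter vanishes. It gives
  -- N ≤ πR² + 1 ≤ 4R² + 64R² ≤ (14R)².
  have h2 : (1 : ℝ) ≤ 2 * Real.pi * R := by
    have := h1.trans (perimeter_disk_le hR)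
    rwa [ENNReal.one_le_ofReal] at this
  rw [whNumber, volume_disk R hR]
  have hlt := Nat.ceil_lt_add_one (show 0 ≤ Real.pi * R ^ 2 by positivity)
  rw [Real.sqrt_le_left (by positivity)]
  refine hlt.le.trans ?_
  have h3 : (1 : ℝ) ≤ (2 * Real.pi * R) ^ 2 := one_le_pow₀ h2
  have hpi := Real.pi_lt_four
  have hpi0 := Real.pi_pos
  have h4 : Real.pi * R ^ 2 ≤ 4 * R ^ 2 := by gcongr
  have h5 : (2 * Real.pi * R) ^ 2 ≤ 64 * R ^ 2 := by
    have : Real.pi ^ 2 ≤ 4 ^ 2 := by gcongr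
    nlinarith [sq_nonneg R]
  nlinarith [sq_nonneg R]

theorem ofReal_sqrt_whNumber_le_perimeter {R : ℝ} (hR : 0 < R) (h1 : 1 ≤ perimeter (disk R)) :
    ENNReal.ofReal (1 / 7 * √(whNumber (disk R) : ℝ)) ≤ perimeter (disk R) := by
  refine le_trans (ENNReal.ofReal_le_ofReal ?_) (le_perimeter_disk hR)
  have := sqrt_whNumber_disk_le hR h1
  linarith

theorem perimeter_le_ofReal_sqrt_whNumber {R : ℝ} (hR : 0 < R) :
    perimeter (disk R) ≤ ENNReal.ofReal (2 * Real.pi * √(whNumber (disk R) : ℝ)) := by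
  refine (perimeter_disk_le hR).trans (ENNReal.ofReal_le_ofReal ?_)
  refine mul_le_mul_of_nonneg_left ?_ (by positivity)
  refine Real.le_sqrt_of_sq_le ?_
  rw [whNumber, volume_disk R hR]
  refine le_trans ?_ (Nat.le_ceil _)
  nlinarith [Real.pi_gt_three, sq_nonneg R]

end Perimeter

/-! ### Transfer to the renormalized kernels -/

section Comparison

open InnerProductSpace

theorem hasSum_quadratic_form {H : Type*} [NormedAddCommGroup H] [InnerProductSpace ℂ H]
    {e : ℕ → H} {lam : ℕ → ℝ} {F G : H}
    (h : HasSum (fun j => ((lam j : ℂ) * inner ℂ (e j) F) • e j) G) :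
    HasSum (fun j => lam j * ‖inner ℂ (e j) F‖ ^ 2) (RCLike.re (inner ℂ F G)) := by
  have h1 := (innerSL ℂ F).hasSum h
  have h2 := Complex.hasSum_re h1
  convert! h2 using 1
  ext j
  simp only [innerSL_apply_apply, inner_smul_right]
  rw [mul_assoc, inner_mul_inner_self_eq, ← Complex.ofReal_mul, Complex.ofReal_re]

theorem hasIntegralKernel_projDiff {p q : ℕ → ℂ → ℂ}
    (hp : ∀ j, MemLp (p j) 2 (volume : Measure ℂ)) (hq : ∀ j, MemLp (q j) 2 (volume : Measure ℂ))
    (N : ℕ) : HasIntegralKernel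
      (projDiff (fun j => (hp j).toLp (p j)) (fun j => (hq j).toLp (q j)) N)
      (fun z w => ∑ j ∈ Finset.range N, p j z * conj (p j w) -
        ∑ j ∈ Finset.range N, q j z * conj (q j w)) := by
  intro F
  have aux : ∀ {p : ℕ → ℂ → ℂ} (hp : ∀ j, MemLp (p j) 2 (volume : Measure ℂ)),
      ∀ᵐ z, Integrable (fun w => (∑ j ∈ Finset.range N, p j z * conj (p j w)) * F w) ∧
        (∑ j ∈ Finset.range N, rankOne ℂ ((hp j).toLp (p j)) ((hp j).toLp (p j)) :
          Lp ℂ 2 (volume : Measure ℂ) →L[ℂ] Lp ℂ 2 (volume : Measure ℂ)) F z =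
        ∫ w, (∑ j ∈ Finset.range N, p j z * conj (p j w)) * F w := by
    intro p hp
    have hint : ∀ j, Integrable fun w => conj (p j w) * F w := fun j =>
      integrable_conj_mul (hp j) (Lp.memLp F)
    have h1 : ∀ᵐ z, ∀ j : ℕ, ((inner ℂ ((hp j).toLp (p j)) F • (hp j).toLp (p j) :
        Lp ℂ 2 (volume : Measure ℂ)) : ℂ → ℂ) z = inner ℂ ((hp j).toLp (p j)) F * p j z := by
      rw [ae_all_iff]
      intro j
      filter_upwards [Lp.coeFn_smul (inner ℂ ((hp j).toLp (p j)) F) ((hp j).toLp (p j)),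
        (hp j).coeFn_toLp] with z hz1 hz2
      rw [hz1, Pi.smul_apply, hz2, smul_eq_mul]
    filter_upwards [h1, Lp.coeFn_finsetSum (Finset.range N)
      fun j => inner ℂ ((hp j).toLp (p j)) F • (hp j).toLp (p j)] with z hz1 hz2
    simp only [_root_.sum_apply, rankOne_apply, Finset.sum_mul, mul_assoc]
    refine ⟨integrable_finsetSum _ fun j _ => (hint j).const_mul _, ?_⟩
    rw [hz2, Finset.sum_apply, integral_finsetSum _ fun j _ => (hint j).const_mul _]
    refine Finset.sum_congr rfl fun j _ => ?_
    rw [hz1, integral_const_mul, inner_toLp_left, mul_comm]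
  rw [projDiff, _root_.sub_apply]
  filter_upwards [aux hp, aux hq, Lp.coeFn_sub
    ((∑ j ∈ Finset.range N, rankOne ℂ ((hp j).toLp (p j)) ((hp j).toLp (p j)) :
      Lp ℂ 2 (volume : Measure ℂ) →L[ℂ] Lp ℂ 2 (volume : Measure ℂ)) F)
    ((∑ j ∈ Finset.range N, rankOne ℂ ((hq j).toLp (q j)) ((hq j).toLp (q j)) :
      Lp ℂ 2 (volume : Measure ℂ) →L[ℂ] Lp ℂ 2 (volume : Measure ℂ)) F)] with z h1 h2 h3
  simp only [sub_mul]
  refine ⟨h1.1.sub h2.1, ?_⟩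
  rw [h3, Pi.sub_apply, h1.2, h2.2, integral_sub h1.1 h2.1]

theorem renormKernel_whKernel (Ω : Set ℂ) (p : ℕ → ℂ → ℂ) (z w : ℂ) :
    renormKernel (whKernel Ω p) z w =
      ∑ j ∈ Finset.range (whNumber Ω), renormFun (p j) z * conj (renormFun (p j) w) := by
  rw [renormKernel, whKernel, Finset.mul_sum]
  refine Finset.sum_congr rfl fun j _ => ?_
  simp only [renormFun, map_mul, ← Complex.exp_conj, map_neg, Complex.conj_ofReal, Complex.conj_I]
  have : cexp (Real.pi * I * (w.re * w.im - z.re * z.im)) =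
      cexp (-(Real.pi * I * (z.re * z.im))) * cexp (-(Real.pi * -I * (w.re * w.im))) := by
    rw [← Complex.exp_add]
    ring_nf
  rw [this]
  ring

theorem purePolyKernel_eq (r N : ℕ) (z w : ℂ) :
    purePolyKernel r N z w =
      ∑ j ∈ Finset.range N, hermiteWigner j r z * conj (hermiteWigner j r w) := by
  rw [purePolyKernel, Finset.mul_sum]
  refine Finset.sum_congr rfl fun j _ => ?_
  rw [hermiteWigner_eq, hermiteWigner_eq, map_mul, Complex.conj_ofReal, mul_add, Real.exp_add]
  push_cast
  ring

theorem exists_traceNorm_le (r N : ℕ) {R : ℝ} (hR : 0 < R) (hN : whNumber (disk R) = N)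
    {lam : ℕ → ℝ} {p : ℕ → ℂ → ℂ} (hE : IsToeplitzExpansion (hermiteFun r) (disk R) lam p) :
    ∃ T : Lp ℂ 2 (volume : Measure ℂ) →L[ℂ] Lp ℂ 2 (volume : Measure ℂ),
      HasIntegralKernel T
        (fun z w => renormKernel (whKernel (disk R) p) z w - purePolyKernel r N z w) ∧
      traceNorm T ≤ ENNReal.ofReal ((2 + 8 * Real.pi * (√3 * (r + 1))) * √(N : ℝ)) := by
  obtain ⟨M, hM, hsum⟩ := hE.expansion
  have hMeq := hasIntegralKernel_unique hM (hasIntegralKernel_toeplitzOperator r hR)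
  have hp := fun j => memLp_renormFun (hE.memLp j)
  have hq := fun j => memLp_renormFun (memLp_hermiteSTFT j r)
  refine ⟨projDiff (fun j => (hp j).toLp (renormFun (p j)))
    (fun j => (hq j).toLp (renormFun (hermiteSTFT j r))) N, ?_, ?_⟩
  · have h := hasIntegralKernel_projDiff hp hq N
    convert! h using 3 with z w
    rw [renormKernel_whKernel, purePolyKernel_eq, hN]
    rfl
  · refine (traceNorm_projDiff_le (orthonormal_renormFun _ hE.orthonormal)
      (orthonormal_renormFun _ (orthonormal_hermiteSTFT r)) hE.lam_antitone
      (fun j => (hE.lam_pos j).le) (toeplitzEigenvalue_nonneg r R) (toeplitzEigenvalue_le_one r R)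
      (summable_toeplitzEigenvalue r hR)
      -- The common form is that of M conjugated by renormalization: by symmetry the coefficient of
      -- F along a renormalized vector is that of the renormalized F along the original one.
      (fun F => RCLike.re (inner ℂ ((memLp_renormFun (Lp.memLp F)).toLp _)
        (M ((memLp_renormFun (Lp.memLp F)).toLp _))))
      (fun F => ?_) (fun F => ?_) N).trans
      (ENNReal.ofReal_le_ofReal (traceNorm_bound_le r N hR hN))
    · simp only [fun j => inner_toLp_renormFun (hE.memLp j) F]
      exact hasSum_quadratic_form (hsum _)
    · simp only [fun j => inner_toLp_renormFun (memLp_hermiteSTFT j r) F]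
      rw [hMeq]
      exact hasSum_quadratic_form (hasSum_toeplitzOperator r hR _)

end Comparison

theorem theorem1p4 :
    -- eigen-expansions exist, and the renormalized eigenfunctions can be taken to be a
    -- rearrangement of the complex Hermite basis of level `r`
    (∀ (r : ℕ) (R : ℝ), 0 < R →
      ∃ (lam : ℕ → ℝ) (p : ℕ → ℂ → ℂ) (σ : Equiv.Perm ℕ),
        IsToeplitzExpansion (hermiteFun r) (disk R) lam p ∧
        ∀ (j : ℕ) (z : ℂ), renormFun (p j) z =
          complexHermite (σ j) r z * (Real.exp (-(Real.pi / 2) * ‖z‖ ^ 2) : ℂ)) ∧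
    -- the trace-norm comparison, for every choice of the eigen-expansion
    (∀ r : ℕ, ∃ C : ℝ, 0 < C ∧
      ∀ (N : ℕ) (R : ℝ), 0 < R → whNumber (disk R) = N →
      ∀ (lam : ℕ → ℝ) (p : ℕ → ℂ → ℂ), IsToeplitzExpansion (hermiteFun r) (disk R) lam p →
        ∃ T : Lp ℂ 2 (volume : Measure ℂ) →L[ℂ] Lp ℂ 2 (volume : Measure ℂ),
          HasIntegralKernel T
            (fun z w => renormKernel (whKernel (disk R) p) z w - purePolyKernel r N z w) ∧
          traceNorm T ≤ ENNReal.ofReal (C * √(N : ℝ)) ∧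
          (1 ≤ perimeter (disk R) → traceNorm T ≤ ENNReal.ofReal C * perimeter (disk R))) ∧
    -- the perimeter is comparable to `√N`
    (∃ c C : ℝ, 0 < c ∧ 0 < C ∧
      ∀ (N : ℕ) (R : ℝ), 0 < R → whNumber (disk R) = N → 1 ≤ perimeter (disk R) →
        ENNReal.ofReal (c * √(N : ℝ)) ≤ perimeter (disk R) ∧
        perimeter (disk R) ≤ ENNReal.ofReal (C * √(N : ℝ))) := by
  refine ⟨fun r R hR => exists_isToeplitzExpansion r hR, fun r => ?_,
    1 / 7, 2 * Real.pi, by norm_num, by positivity, fun N R hR hN h1 => ?_⟩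
  · set A : ℝ := 2 + 8 * Real.pi * (√3 * (r + 1)) with hA
    have hA0 : 0 < A := by positivity
    -- The factor 7 pays for replacing √N by the perimeter, which is at least √N / 7; the first
    -- bound holds already with A.
    refine ⟨7 * A, by positivity, fun N R hR hN lam p hE => ?_⟩
    obtain ⟨T, hT, hle⟩ := exists_traceNorm_le r N hR hN hE
    rw [← hA] at hle
    refine ⟨T, hT, hle.trans (ENNReal.ofReal_le_ofReal ?_), fun h1 => hle.trans ?_⟩
    · exact mul_le_mul_of_nonneg_right (by linarith) (Real.sqrt_nonneg _)
    · have h2 := ofReal_sqrt_whNumber_le_perimeter hR h1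
      rw [hN] at h2
      rw [show A * √(N : ℝ) = 7 * A * (1 / 7 * √(N : ℝ)) by ring,
        ENNReal.ofReal_mul (by positivity)]
      gcongr
  · rw [← hN]
    exact ⟨ofReal_sqrt_whNumber_le_perimeter hR h1, perimeter_le_ofReal_sqrt_whNumber hR⟩
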